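/- **Setting.** Let $\kappa\ge 3$ and $n\geq 1$ be integers; indices $j\in\{1,\dots,\kappa\}$ are cyclic. Let $\mathfrak C_\kappa\subset\mathbb R^2$ be the regular $\kappa$-gon of area $1$ in the upper half-plane whose first side is the segment from $(0,0)$ to $(r_\kappa,0)$, with $r_\kappa=(4\tan(\pi/\kappa)/\kappa)^{1/2}$; its sides are numbered counterclockwise, $e_j$ is the unit vector directing the $j$-th side, and $\theta_\kappa=(\kappa-2)\pi/\kappa$ is its interior angle. Let $\mathcal C_\kappa(n)$ be the set of $n$-tuples $z=(z_1,\dots,z_n)$ of points of $\mathfrak C_\kappa$ that are in convex position and in canonical order: $z_1$ is the lowest point (the leftmost one in case of a tie), and the arguments in $[0,2\pi)$ of $z_2-z_1,\dots,z_n-z_{n-1},z_1-z_n$ are nondecreasing. For $z\in\mathcal C_\kappa(n)$ let $\ell_j$ be the distance from the line carrying the $j$-th side of $\mathfrak C_\kappa$ to $\{z_1,\dots,z_n\}$, let $\mathrm{ECP}(z)$ be the intersection of all polygons containing $z$ whose sides are parallel, one by one, to those of $\mathfrak C_\kappa$, and let $\mathsf{cp}_j$ be the (lexicographically smallest) point of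 $z$ on the $j$-th side of $\mathrm{ECP}(z)$. The length of that side is $$c_j=c_j(\ell)=r_\kappa-\frac{\ell_{j-1}+\ell_{j+1}+2\ell_j\cos\theta_\kappa}{\sin\theta_\kappa}.$$ The size vector $s=(s_1,\dots,s_\kappa)$ of $z$ is given by: if $z_k=\mathsf{cp}_{j-1}$, then $z_{k+s_j}=\mathsf{cp}_j$ with $0\le s_j<n$ (indices of points modulo $n$). Let $\mathbb N_\kappa(n)$ be the set of $s\in\mathbb N^\kappa$ with $\sum_j s_j=n$ and $s_{j-1}+s_j\ne0$ for all $j$. For $s\in\mathbb N_\kappa(n)$, let $\mathcal C_\kappa(s)$ be the set of $z\in\mathcal C_\kappa(n)$ with size vector $s$, and put $N_j=s_j+s_{j+1}-1$. Define $\chi_s(z)=(\ell,u^{(1)},\dots,u^{(\kappa)})\in\mathbb R^\kappa\times\prod_j\mathbb R^{N_j}$, where the side-partition $u^{(j)}=(u^{(j)}_1,\dots,u^{(j)}_{N_j})$ is as follows. Let $z_{k_0}=\mathsf{cp}_{j-1}$, so that $z_{k_0+s_j}=\mathsf{cp}_j$. Then $u^{(j)}_k$ is the abscissa, measured along $e_j$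 from the starting point of the $j$-th side of $\mathrm{ECP}(z)$ (the intersection of its $(j-1)$-th and $j$-th side lines), of the projection of $z_{k_0+k}$ to that side line, parallel to $e_{j-1}$ if $k\le s_j$ and parallel to $e_{j+1}$ if $k>s_j$. Let $\mathcal S^{(n)}(s)$ be the set of $(\ell,w^{(1)},\dots,w^{(\kappa)})\in\mathbb R^\kappa\times\prod_j\mathbb R^{N_j}$ such that, for all $j$: $\ell_j\ge0$; $c_j=c_j(\ell)>0$; $0<w^{(j)}_1<\dots<w^{(j)}_{N_j}<c_j$; and, with $w^{(j)}_0=0$, $w^{(j)}_{N_j+1}=c_j$ and $\Delta w^{(j)}_i=w^{(j)}_i-w^{(j)}_{i-1}$, $$\frac{\Delta w^{(j)}_1}{\Delta w^{(j-1)}_{s_{j-1}+1}}<\dots<\frac{\Delta w^{(j)}_{s_j}}{\Delta w^{(j-1)}_{s_{j-1}+s_j}}.$$ **Theorem.** For every $s\in\mathbb N_\kappa(n)$, the map $\chi_s$ is a piecewise diffeomorphism from $\mathcal C_\kappa(s)$ onto $\mathcal S^{(n)}(s)$: there are finitely many Lebesgue measurable sets $P_1,\dots,P_m\subseteq\mathcal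 C_\kappa(s)$ whose interiors are pairwise disjoint and cover $\mathcal C_\kappa(s)$ up to a Lebesgue null set, such that $\chi_s$ restricts to a $C^\infty$ diffeomorphism from each $P_i^\circ$ onto an open set contained in $\mathcal S^{(n)}(s)$, and the images $\chi_s(P_i^\circ)$ are pairwise disjoint and cover $\mathcal S^{(n)}(s)$ up to a Lebesgue null set. With a suitable numbering of the coordinates, the same for all $i$, the Jacobian determinant of $\chi_s$ on every $P_i^\circ$ is constant and equal to $1/\sin(\theta_\kappa)^{n-\kappa}$. In particular, $$\mathrm{Leb}_{2n}(\mathcal C_\kappa(s))=\mathrm{Leb}_{2n}(\mathcal S^{(n)}(s))\,\sin(\theta_\kappa)^{n-\kappa}.$$ -/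

import Mathlib

open MeasureTheory Set
open scoped ContDiff BigOperators

noncomputable section

namespace Kgon

/-! The plane is `ℂ`. The sides of the regular `κ`-gon are indexed by `Fin κ` counterclockwise,
index `0` being the side on the X-axis; `j + 1` and `j - 1` are cyclic. Likewise the points of an
`n`-tuple are indexed cyclically by `Fin n`. -/

/-- The interior angle of the regular `κ`-gon. -/
def theta (κ : ℕ) : ℝ := ((κ : ℝ) - 2) * Real.pi / κ

/-- The side length of the regular `κ`-gon of area `1`. -/
def sideLen (κ : ℕ) : ℝ := Real.sqrt (4 * Real.tan (Real.pi / κ) / κ)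

/-- The unit vector directing the `j`-th side of the regular `κ`-gon (counterclockwise). -/
def dir (κ : ℕ) (j : Fin κ) : ℂ :=
  Complex.exp (((2 * Real.pi * (j : ℕ) / κ : ℝ) : ℂ) * Complex.I)

/-- The starting point of the `j`-th side of the regular `κ`-gon; the `0`-th one is the origin. -/
def corner (κ : ℕ) (j : Fin κ) : ℂ := (sideLen κ : ℂ) * ∑ t ∈ Finset.Iio j, dir κ t

/-- The signed distance from `p` to the line carrying the `j`-th side of the regular `κ`-gon,
counted positively on the side of the polygon. -/
def height (κ : ℕ) (j : Fin κ) (p : ℂ) : ℝ :=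
  ((starRingEnd ℂ) (dir κ j) * (p - corner κ j)).im

/-- The polygon with sides parallel to those of the regular `κ`-gon, its `j`-th side lying on the
line at (signed) distance `t j` from the `j`-th side line. -/
def equiPolygon (κ : ℕ) (t : Fin κ → ℝ) : Set ℂ := {p | ∀ j, t j ≤ height κ j p}

/-- The regular `κ`-gon of area `1`, standing on the X-axis. -/
def regularPolygon (κ : ℕ) : Set ℂ := equiPolygon κ 0

/-- The argument of a vector, taken in `[0, 2π)`. -/
def angle (v : ℂ) : ℝ := toIcoMod Real.two_pi_pos 0 v.arg

/-- `z` is in convex position and in canonical convex order: its first point is the lowest one (the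
leftmost one among the lowest), and the arguments of the successive boundary vectors (including the
one that closes the polygon) are nondecreasing in `[0, 2π)`. -/
def IsCanonicalConvex {n : ℕ} [NeZero n] (z : Fin n → ℂ) : Prop :=
  ConvexIndependent ℝ z ∧
  (∀ i, (z 0).im < (z i).im ∨ ((z 0).im = (z i).im ∧ (z 0).re ≤ (z i).re)) ∧
  Monotone fun i : Fin n => angle (z (i + 1) - z i)

/-- The set `𝒞_κ(n)` of `n`-tuples of points of the regular `κ`-gon that are in convex position and
in canonical convex order. -/
def convexTuples (κ n : ℕ) [NeZero n] : Set (Fin n → ℂ) :=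
  {z | IsCanonicalConvex z ∧ ∀ i, z i ∈ regularPolygon κ}

/-- `ℓ_j(z)`: the distance of the tuple `z` to the line carrying the `j`-th side. -/
def ell (κ : ℕ) {n : ℕ} (z : Fin n → ℂ) (j : Fin κ) : ℝ := ⨅ i, height κ j (z i)

/-- The equiangular circumscribed polygon of `z`: the intersection of all the polygons with sides
parallel to those of the regular `κ`-gon that contain `z`. -/
def ecp (κ : ℕ) {n : ℕ} (z : Fin n → ℂ) : Set ℂ :=
  ⋂ (t : Fin κ → ℝ) (_ : ∀ i, z i ∈ equiPolygon κ t), equiPolygon κ t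

theorem ecp_eq (κ : ℕ) {n : ℕ} [NeZero n] (z : Fin n → ℂ) :
    ecp κ z = equiPolygon κ (ell κ z) := by
  apply Subset.antisymm
  · refine iInter₂_subset (ell κ z) fun i j => ?_
    exact ciInf_le (Set.finite_range fun i => height κ j (z i)).bddBelow i
  · intro p hp
    refine mem_iInter₂.2 fun t ht j => ?_
    exact (le_ciInf fun i => ht i j).trans (hp j)

/-- The `j`-th side of the circumscribed polygon. -/
def ecpSide (κ : ℕ) {n : ℕ} (z : Fin n → ℂ) (j : Fin κ) : Set ℂ :=
  {p | p ∈ ecp κ z ∧ height κ j p = ell κ z j}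

theorem exists_contact (κ : ℕ) {n : ℕ} [NeZero n] (z : Fin n → ℂ) (j : Fin κ) :
    ∃ i : Fin n, z i ∈ ecpSide κ z j ∧
      ∀ i', z i' ∈ ecpSide κ z j →
        toLex ((z i).re, (z i).im) ≤ toLex ((z i').re, (z i').im) := by
  have hmem : ∀ i, z i ∈ ecp κ z := fun i => mem_iInter₂.2 fun t ht => ht i
  obtain ⟨i₀, hi₀⟩ := exists_eq_ciInf_of_finite (f := fun i => height κ j (z i))
  have hne : {i : Fin n | z i ∈ ecpSide κ z j}.Nonempty := ⟨i₀, hmem i₀, hi₀⟩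
  exact Set.exists_min_image {i : Fin n | z i ∈ ecpSide κ z j}
    (fun i => toLex ((z i).re, (z i).im)) (Set.toFinite _) hne

/-- The index `k` such that `z k` is the `j`-th contact point `cp_j(z)`: the lexicographically
smallest point of the tuple on the `j`-th side of the circumscribed polygon. -/
def contactIndex (κ : ℕ) {n : ℕ} [NeZero n] (z : Fin n → ℂ) (j : Fin κ) : Fin n :=
  (exists_contact κ z j).choose

/-- The size vector of `z`: `s_j` is the number of boundary vectors of `z` in the corner between the
sides `j - 1` and `j`, i.e. if `z k = cp_{j-1}` then `z (k + s_j) = cp_j` (indices modulo `n`). -/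
def sizeVector (κ : ℕ) [NeZero κ] {n : ℕ} [NeZero n] (z : Fin n → ℂ) (j : Fin κ) : ℕ :=
  ((contactIndex κ z j - contactIndex κ z (j - 1) : Fin n) : ℕ)

/-- The set `ℕ_κ(n)` of admissible size vectors. -/
def sizeVectors (κ n : ℕ) [NeZero κ] : Set (Fin κ → ℕ) :=
  {s | ∑ j, s j = n ∧ ∀ j, s (j - 1) + s j ≠ 0}

/-- The set `𝒞_κ(s)` of convex tuples with size vector `s`. -/
def convexTuplesOfSize (κ n : ℕ) [NeZero κ] [NeZero n] (s : Fin κ → ℕ) : Set (Fin n → ℂ) :=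
  {z | z ∈ convexTuples κ n ∧ sizeVector κ z = s}

/-- The side lengths `c_j` of the circumscribed polygon as a function of the distances `ℓ`
(see `ecpVertex_sub`). -/
def sideLength (κ : ℕ) [NeZero κ] (ℓ : Fin κ → ℝ) (j : Fin κ) : ℝ :=
  sideLen κ - (ℓ (j - 1) + ℓ (j + 1) + 2 * ℓ j * Real.cos (theta κ)) / Real.sin (theta κ)

/-- The starting point of the `j`-th side of the circumscribed polygon with distances `ℓ`, that is
the intersection point of its side lines `j - 1` and `j` (see `height_ecpVertex`). -/
def ecpVertex (κ : ℕ) [NeZero κ] (ℓ : Fin κ → ℝ) (j : Fin κ) : ℂ :=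
  corner κ j + ((ℓ (j - 1) : ℂ) * dir κ j - (ℓ j : ℂ) * dir κ (j - 1)) / (Real.sin (theta κ) : ℂ)

theorem dir_add_one (κ : ℕ) [NeZero κ] (j : Fin κ) :
    dir κ (j + 1) = dir κ j * Complex.exp (((2 * Real.pi / κ : ℝ) : ℂ) * Complex.I) := by
  have hκ : (κ : ℝ) ≠ 0 := Nat.cast_ne_zero.2 (NeZero.ne κ)
  obtain ⟨m, rfl⟩ := Nat.exists_eq_succ_of_ne_zero (NeZero.ne κ)
  unfold dir
  rw [← Complex.exp_add]
  by_cases h : j = Fin.last m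
  · subst h
    rw [Fin.last_add_one]
    have : ((2 * Real.pi * ((Fin.last m : Fin (m + 1)) : ℕ) / ((m.succ : ℕ) : ℝ) : ℝ) : ℂ) * Complex.I +
        ((2 * Real.pi / ((m.succ : ℕ) : ℝ) : ℝ) : ℂ) * Complex.I = 2 * Real.pi * Complex.I := by
      rw [← add_mul, ← Complex.ofReal_add]
      congr 1
      have : (2 * Real.pi * ((Fin.last m : Fin (m + 1)) : ℕ) / ((m.succ : ℕ) : ℝ) : ℝ) +
        (2 * Real.pi / ((m.succ : ℕ) : ℝ) : ℝ) = 2 * Real.pi := by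
        field_simp
        simp
      rw [this]; push_cast; ring
    rw [this, Complex.exp_two_pi_mul_I]
    simp
  · rw [Fin.val_add_one_of_lt (lt_of_le_of_ne (Fin.le_last j) h)]
    congr 1
    push_cast
    ring

theorem corner_add_one {κ : ℕ} [NeZero κ] (hκ : 2 ≤ κ) (j : Fin κ) :
    corner κ (j + 1) = corner κ j + (sideLen κ : ℂ) * dir κ j := by
  obtain ⟨m, rfl⟩ := Nat.exists_eq_succ_of_ne_zero (NeZero.ne κ)
  unfold corner
  rw [← mul_add]
  congr 1
  have hins : ∑ t ∈ Finset.Iic j, dir m.succ t = ∑ t ∈ Finset.Iio j, dir m.succ t + dir m.succ j := by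
    rw [← Finset.Iio_insert, Finset.sum_insert (by simp)]
    ring
  rw [← hins]
  by_cases h : j = Fin.last m
  · subst h
    rw [Fin.last_add_one]
    have h1 : Finset.Iio (0 : Fin (m + 1)) = ∅ := by ext; simp
    have h2 : Finset.Iic (Fin.last m) = Finset.univ := by
      ext x
      simpa using Fin.le_last x
    rw [h1, h2, Finset.sum_empty]
    have hprim := Complex.isPrimitiveRoot_exp (m + 1) (by omega)
    have hg := hprim.geom_sum_eq_zero (by omega)
    rw [← Fin.sum_univ_eq_sum_range (fun i => Complex.exp (2 * Real.pi * Complex.I / ((m + 1 : ℕ) : ℂ)) ^ i)] at hg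
    rw [← hg]
    refine Finset.sum_congr rfl fun t _ => ?_
    unfold dir
    rw [← Complex.exp_nat_mul]
    congr 1
    push_cast
    ring
  · congr 1
    ext x
    have hl : j < Fin.last m := lt_of_le_of_ne (Fin.le_last j) h
    have : ((j + 1 : Fin (m + 1)) : ℕ) = j + 1 := Fin.val_add_one_of_lt hl
    simp only [Finset.mem_Iio, Finset.mem_Iic, Fin.lt_def, Fin.le_def, this]
    omega

theorem sin_theta {κ : ℕ} [NeZero κ] : Real.sin (theta κ) = Real.sin (2 * Real.pi / κ) := by
  have hκ : (κ : ℝ) ≠ 0 := Nat.cast_ne_zero.2 (NeZero.ne κ)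
  have : theta κ = Real.pi - 2 * Real.pi / κ := by unfold theta; field_simp
  rw [this, Real.sin_pi_sub]

theorem cos_theta {κ : ℕ} [NeZero κ] : Real.cos (theta κ) = -Real.cos (2 * Real.pi / κ) := by
  have hκ : (κ : ℝ) ≠ 0 := Nat.cast_ne_zero.2 (NeZero.ne κ)
  have : theta κ = Real.pi - 2 * Real.pi / κ := by unfold theta; field_simp
  rw [this, Real.cos_pi_sub]

theorem sin_theta_pos {κ : ℕ} (hκ : 3 ≤ κ) : 0 < Real.sin (theta κ) := by
  have : NeZero κ := ⟨by omega⟩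
  have h3 : (3 : ℝ) ≤ κ := by exact_mod_cast hκ
  rw [sin_theta]
  apply Real.sin_pos_of_pos_of_lt_pi
  · have := Real.pi_pos; positivity
  · rw [div_lt_iff₀ (by linarith)]
    nlinarith [Real.pi_pos]

theorem conj_dir_mul_dir (κ : ℕ) (j : Fin κ) : (starRingEnd ℂ) (dir κ j) * dir κ j = 1 := by
  rw [mul_comm, Complex.mul_conj, Complex.normSq_eq_norm_sq]
  unfold dir
  rw [Complex.norm_exp_ofReal_mul_I]
  simp

/-- The starting point of the `j`-th side lies on the lines of the sides `j - 1` and `j`. -/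
theorem height_ecpVertex {κ : ℕ} [NeZero κ] (hκ : 3 ≤ κ) (ℓ : Fin κ → ℝ) (j : Fin κ) :
    height κ (j - 1) (ecpVertex κ ℓ j) = ℓ (j - 1) ∧ height κ j (ecpVertex κ ℓ j) = ℓ j := by
  have hs := (sin_theta_pos hκ).ne'
  obtain ⟨i, rfl⟩ : ∃ i, j = i + 1 := ⟨j - 1, by simp⟩
  have hi : (starRingEnd ℂ) (dir κ i) * dir κ i = 1 := conj_dir_mul_dir κ i
  set w := Complex.exp (((2 * Real.pi / κ : ℝ) : ℂ) * Complex.I) with hw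
  have hwim : w.im = Real.sin (theta κ) := by rw [sin_theta, hw, Complex.exp_ofReal_mul_I_im]
  have hww : (starRingEnd ℂ) w * w = 1 := by
    rw [mul_comm, Complex.mul_conj, Complex.normSq_eq_norm_sq, hw, Complex.norm_exp_ofReal_mul_I]
    simp
  have hsC : (Real.sin (theta κ) : ℂ) ≠ 0 := by exact_mod_cast hs
  have e1 : (starRingEnd ℂ) (dir κ i) * (corner κ i + (sideLen κ : ℂ) * dir κ i +
      ((ℓ i : ℂ) * (dir κ i * w) - (ℓ (i + 1) : ℂ) * dir κ i) / (Real.sin (theta κ) : ℂ) - corner κ i) =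
      (sideLen κ : ℂ) + ((ℓ i / Real.sin (theta κ) : ℝ) : ℂ) * w -
        ((ℓ (i + 1) / Real.sin (theta κ) : ℝ) : ℂ) := by
    push_cast [-Complex.ofReal_sin]
    linear_combination ((sideLen κ : ℂ) + (ℓ i / (Real.sin (theta κ)) : ℂ) * w -
        (ℓ (i + 1) / (Real.sin (theta κ)) : ℂ)) * hi
  have e2 : (starRingEnd ℂ) (dir κ i * w) * (corner κ (i + 1) +
      ((ℓ i : ℂ) * (dir κ i * w) - (ℓ (i + 1) : ℂ) * dir κ i) / (Real.sin (theta κ) : ℂ) - corner κ (i + 1)) =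
      ((ℓ i / Real.sin (theta κ) : ℝ) : ℂ) -
        ((ℓ (i + 1) / Real.sin (theta κ) : ℝ) : ℂ) * (starRingEnd ℂ) w := by
    push_cast [-Complex.ofReal_sin]
    rw [map_mul]
    linear_combination (((ℓ i / (Real.sin (theta κ)) : ℂ) * w * (starRingEnd ℂ) w -
        (ℓ (i + 1) / (Real.sin (theta κ)) : ℂ) * (starRingEnd ℂ) w)) * hi +
        (ℓ i / (Real.sin (theta κ)) : ℂ) * hww
  constructor
  · rw [height, ecpVertex, add_sub_cancel_right, corner_add_one (by omega), dir_add_one, ← hw, e1,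
      Complex.sub_im, Complex.add_im, Complex.im_ofReal_mul, hwim]
    simp only [Complex.ofReal_im]
    field_simp
    ring
  · rw [height, ecpVertex, add_sub_cancel_right, dir_add_one, ← hw, e2,
      Complex.sub_im, Complex.im_ofReal_mul, Complex.conj_im, hwim]
    simp only [Complex.ofReal_im]
    field_simp
    ring

/-- The `j`-th side of the circumscribed polygon is directed by `dir κ j` and has length
`sideLength κ ℓ j`. -/
theorem ecpVertex_sub {κ : ℕ} [NeZero κ] (hκ : 3 ≤ κ) (ℓ : Fin κ → ℝ) (j : Fin κ) :
    ecpVertex κ ℓ (j + 1) - ecpVertex κ ℓ j = (sideLength κ ℓ j : ℂ) * dir κ j := by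
  have hs := (sin_theta_pos hκ).ne'
  obtain ⟨i, rfl⟩ : ∃ i, j = i + 1 := ⟨j - 1, by simp⟩
  have hsC : (Real.sin (theta κ) : ℂ) ≠ 0 := by exact_mod_cast hs
  set w := Complex.exp (((2 * Real.pi / κ : ℝ) : ℂ) * Complex.I) with hw
  have hww : w * w + 1 = -2 * (Real.cos (theta κ) : ℂ) * w := by
    have h1 : w * (starRingEnd ℂ) w = 1 := by
      rw [Complex.mul_conj, Complex.normSq_eq_norm_sq, hw, Complex.norm_exp_ofReal_mul_I]
      simp
    have h2 : w + (starRingEnd ℂ) w = -2 * (Real.cos (theta κ) : ℂ) := by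
      rw [Complex.add_conj, hw, Complex.exp_ofReal_mul_I_re, cos_theta]
      push_cast
      ring
    linear_combination w * h2 - h1
  rw [ecpVertex, ecpVertex, sideLength, add_sub_cancel_right, add_sub_cancel_right,
    corner_add_one (by omega) (i + 1), dir_add_one κ (i + 1), dir_add_one κ i, ← hw]
  push_cast [-Complex.ofReal_sin, -Complex.ofReal_cos]
  field_simp
  linear_combination (ℓ (i + 1) : ℂ) * dir κ i * hww

/-- The set `ℒ*_κ` of the distances `ℓ` of the equiangular polygons inside the regular `κ`-gon whose
side lengths are all positive. -/
def ellSet (κ : ℕ) [NeZero κ] : Set (Fin κ → ℝ) :=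
  {ℓ | (∀ j, 0 ≤ ℓ j) ∧ ∀ j, 0 < sideLength κ ℓ j}

/-- `N_j = s_j + s_{j+1} - 1`. -/
def numPart {κ : ℕ} [NeZero κ] (s : Fin κ → ℕ) (j : Fin κ) : ℕ := s j + s (j + 1) - 1

/-- The coefficient `y` of `e` in the decomposition `v = x a + y e`. -/
def obliqueCoord (a e v : ℂ) : ℝ :=
  ((starRingEnd ℂ) a * v).im / ((starRingEnd ℂ) a * e).im

/-- The `j`-th side partition `u^{(j)}` of `z`. The points `z_{k₀ + k}`, where `z_{k₀} = cp_{j-1}`,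
are projected on the `j`-th side of the circumscribed polygon, parallel to the side `j - 1` as long
as they belong to the corner between the sides `j - 1` and `j` (`k ≤ s_j`, with `z_{k₀ + s_j} = cp_j`)
and parallel to the side `j + 1` when they belong to the next corner (`s_j < k`); then
`u^{(j)}_k` (`1 ≤ k ≤ N_j`) is the distance of this projection to the starting point of the side.
Thus the successive increments of `u^{(j)}` are the components along the `j`-th side of the boundary
vectors in these two corners. -/
def sidePartition (κ : ℕ) [NeZero κ] {n : ℕ} [NeZero n] (s : Fin κ → ℕ) (z : Fin n → ℂ)
    (j : Fin κ) (i : Fin (numPart s j)) : ℝ :=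
  let k : ℕ := (i : ℕ) + 1
  let v : ℂ := z (contactIndex κ z (j - 1) + Fin.ofNat n k) - ecpVertex κ (ell κ z) j
  if k ≤ s j then obliqueCoord (dir κ (j - 1)) (dir κ j) v
  else obliqueCoord (dir κ (j + 1)) (dir κ j) v

/-- The space `ℝ^κ × ∏_j ℝ^{N_j}`. -/
abbrev ParamSpace {κ : ℕ} [NeZero κ] (s : Fin κ → ℕ) : Type :=
  (Fin κ → ℝ) × ((j : Fin κ) → Fin (numPart s j) → ℝ)

/-- The extraction map `χ_s`. -/
def chi (κ n : ℕ) [NeZero κ] [NeZero n] (s : Fin κ → ℕ) (z : Fin n → ℂ) : ParamSpace s :=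
  (ell κ z, sidePartition κ s z)

/-- The simplex `P[c, k] = {0 < a_1 < ... < a_k < c}`. -/
def simplexP (c : ℝ) (k : ℕ) : Set (Fin k → ℝ) :=
  {a | StrictMono a ∧ ∀ i, 0 < a i ∧ a i < c}

/-- The extension of `a = (a_1, ..., a_k)` by `a_0 = 0` and `a_{k+1} = c`. -/
def extend (c : ℝ) {k : ℕ} (a : Fin k → ℝ) (i : ℕ) : ℝ :=
  if i = 0 then 0 else if h : i - 1 < k then a ⟨i - 1, h⟩ else c

/-- The increment `Δa_i = a_i - a_{i-1}`, `1 ≤ i ≤ k + 1`. -/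
def incr (c : ℝ) {k : ℕ} (a : Fin k → ℝ) (i : ℕ) : ℝ := extend c a i - extend c a (i - 1)

/-- The set `𝒮^{(n)}(s)`. -/
def paramSet (κ : ℕ) [NeZero κ] (s : Fin κ → ℕ) : Set (ParamSpace s) :=
  {x | x.1 ∈ ellSet κ ∧
    (∀ j, x.2 j ∈ simplexP (sideLength κ x.1 j) (numPart s j)) ∧
    ∀ j, StrictMonoOn
      (fun k : ℕ => incr (sideLength κ x.1 j) (x.2 j) k /
        incr (sideLength κ x.1 (j - 1)) (x.2 (j - 1)) (s (j - 1) + k))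
      (Set.Icc 1 (s j))}

/-- `g` is a piecewise diffeomorphism from `A` onto `B` with pieces `P`: the interiors of the
finitely many measurable sets `P i ⊆ A` partition `A` up to a Lebesgue null set, `g` restricts to a
smooth diffeomorphism from each of them onto an open subset of `B`, and these images partition `B`
up to a Lebesgue null set. -/
structure IsPiecewiseDiffeo {E F : Type*} [NormedAddCommGroup E] [NormedSpace ℝ E] [MeasureSpace E]
    [NormedAddCommGroup F] [NormedSpace ℝ F] [MeasureSpace F]
    (g : E → F) (A : Set E) (B : Set F) {m : ℕ} (P : Fin m → Set E) : Prop where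
  measurable : ∀ i, NullMeasurableSet (P i) volume
  subset : ∀ i, P i ⊆ A
  disjoint : Pairwise fun i i' => Disjoint (interior (P i)) (interior (P i'))
  cover : volume (A \ ⋃ i, interior (P i)) = 0
  smooth : ∀ i, ContDiffOn ℝ ∞ g (interior (P i))
  open_image : ∀ i, IsOpen (g '' interior (P i))
  smooth_inverse : ∀ i, ∃ h : F → E,
    ContDiffOn ℝ ∞ h (g '' interior (P i)) ∧ LeftInvOn h g (interior (P i))
  image_subset : ∀ i, g '' interior (P i) ⊆ B
  image_disjoint : Pairwise fun i i' => Disjoint (g '' interior (P i)) (g '' interior (P i'))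
  image_cover : volume (B \ ⋃ i, g '' interior (P i)) = 0

/-- The determinant of a linear map `(ℝ²)^n → ℝ^κ × ∏_j ℝ^{N_j}` in the canonical bases, the
numbering `e` of the coordinates of the target being given. -/
def detWith {κ n : ℕ} [NeZero κ] {s : Fin κ → ℕ}
    (e : (Σ _ : Fin n, Fin 2) ≃ Fin κ ⊕ (Σ j : Fin κ, Fin (numPart s j)))
    (L : (Fin n → ℂ) →ₗ[ℝ] ParamSpace s) : ℝ :=
  ((LinearMap.toMatrix (Pi.basis fun _ : Fin n => Complex.basisOneI)
    ((Pi.basisFun ℝ (Fin κ)).prod (Pi.basis fun j => Pi.basisFun ℝ (Fin (numPart s j))))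
    L).submatrix e id).det

end Kgon

end

/-!
The tuples of `convexTuplesOfSize κ n s` all have the same contact points: the contact point of the
bottom side is the first point, and the size vector gives the other ones, `cp_j` being the point
with index `s_1 + ... + s_j` modulo `n` (`contactPos`). With the contact points fixed, the formulas
defining `chi` are affine in `z`; they define the map `affineChi`. Hence one piece is enough: the
preimage `openPiece` under `affineChi` of the open set `openParamSet`, the part of `paramSet` where
all distances `ℓ_j` are positive.

The increments of the side partitions are the coordinates of the boundary vectors of the corner
between the sides `j - 1` and `j` in the basis of the two side directions
(`incr_affineChi_left`, `incr_affineChi_right`). So the conditions defining `paramSet` say that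
each boundary vector points strictly between the directions of the two sides of its corner, and that
the arguments increase strictly (`IsCornerSorted`), the slope in this basis being an increasing
function of the argument.

* A closed polygon whose boundary vectors have strictly increasing arguments in `(0, 2π)` is
  convex, and its lowest point over a direction `φ` is the one where the arguments pass `φ`
  (`cross_pos_of_liftedAngle`). This yields convexity, the contact points and the size vector, so
  `openPiece` consists of convex tuples on which `chi = affineChi`.
* Conversely, at a contact point of a convex tuple without boundary vector parallel to a side, the
  arguments pass the direction of the side (`angle_lt_and_lt_angle`). So `openPiece` misses only
  tuples that have a point on a side line or a boundary vector parallel to a side, which form a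
  null set.

For the determinant, the displacement of the vertices of the circumscribed polygon contributes a
shear of determinant one. What remains is block diagonal, since each point determines exactly two
coordinates (`cornerCoord`). The block of a point has determinant `1 / sin θ` if it is not a contact
point, `1` if it is the contact point of one side, and `sin θ` if it is the contact point of two
sides; a corner with `s_j > 0` has `s_j - 1` points of the first kind, and those with `s_j = 0`
correspond to the points of the last kind, so that the product is `sin θ ^ (κ - n)`.
-/

set_option linter.unusedSectionVars false

namespace Kgon

/-! ### Cyclic indices and partial sums of the size vector -/

theorem ofNat_add (n : ℕ) [NeZero n] (a b : ℕ) :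
    Fin.ofNat n (a + b) = Fin.ofNat n a + Fin.ofNat n b := by
  ext; simp [Fin.val_add, Fin.ofNat]

theorem ofNat_self (n : ℕ) [NeZero n] : Fin.ofNat n n = 0 := by
  ext; simp [Fin.ofNat]

theorem ofNat_val {n : ℕ} [NeZero n] (m : Fin n) : Fin.ofNat n (m : ℕ) = m := by
  ext; simp [Fin.ofNat, Nat.mod_eq_of_lt m.2]

theorem ofNat_zero (n : ℕ) [NeZero n] : Fin.ofNat n 0 = 0 := by
  ext; simp [Fin.ofNat]

theorem ofNat_one (n : ℕ) [NeZero n] : Fin.ofNat n 1 = 1 := by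
  ext; simp [Fin.ofNat]

theorem ofNat_val_add_one {n : ℕ} [NeZero n] (m : Fin n) : Fin.ofNat n (m + 1 : ℕ) = m + 1 := by
  rw [ofNat_add, ofNat_val, ofNat_one]

theorem val_ofNat_of_lt {n : ℕ} [NeZero n] {k : ℕ} (h : k < n) : (Fin.ofNat n k : ℕ) = k := by
  simp [Fin.ofNat, Nat.mod_eq_of_lt h]

/-- The number `s_1 + ... + s_c` of boundary vectors in the corners that precede the `c`-th side,
counted from side `0`. -/
def partialSum {κ : ℕ} [NeZero κ] (s : Fin κ → ℕ) (c : ℕ) : ℕ :=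
  ∑ t ∈ Finset.range c, s (Fin.ofNat κ (t + 1))

/-- The index that the contact point of the `j`-th side has in a generic tuple with size
vector `s`. -/
def contactPos {κ : ℕ} [NeZero κ] (n : ℕ) [NeZero n] (s : Fin κ → ℕ) (j : Fin κ) : Fin n :=
  Fin.ofNat n (partialSum s j)

variable {κ n : ℕ} [NeZero κ] [NeZero n]

theorem partialSum_zero (s : Fin κ → ℕ) : partialSum s 0 = 0 := by simp [partialSum]

theorem partialSum_val_add_one (s : Fin κ → ℕ) (i : Fin κ) :
    partialSum s (i + 1 : ℕ) = partialSum s i + s (i + 1) := by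
  rw [partialSum, Finset.sum_range_succ, ofNat_val_add_one]; rfl

theorem partialSum_mono (s : Fin κ → ℕ) : Monotone (partialSum s) := fun _ _ h =>
  Finset.sum_le_sum_of_subset (Finset.range_mono h)

theorem partialSum_card (s : Fin κ → ℕ) : partialSum s κ = ∑ j, s j := by
  rw [partialSum, ← Fin.sum_univ_eq_sum_range (fun t => s (Fin.ofNat κ (t + 1)))]
  simp_rw [ofNat_val_add_one]
  exact Equiv.sum_comp (Equiv.addRight (1 : Fin κ)) s

theorem partialSum_le (s : Fin κ → ℕ) (hs : ∑ j, s j = n) {c : ℕ} (hc : c ≤ κ) :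
    partialSum s c ≤ n := by
  rw [← hs, ← partialSum_card]; exact partialSum_mono s hc

theorem contactPos_zero (s : Fin κ → ℕ) : contactPos n s 0 = 0 := by
  simp [contactPos, partialSum_zero]

theorem ofNat_partialSum_add_one (s : Fin κ → ℕ) (hs : ∑ j, s j = n) (i : Fin κ) :
    Fin.ofNat n (partialSum s (i + 1 : ℕ)) = contactPos n s (i + 1) := by
  rcases eq_or_ne (i + 1 : ℕ) κ with h | h
  · have h0 : i + 1 = 0 := by rw [← ofNat_val_add_one, h, ofNat_self]
    rw [h0, contactPos_zero, h, partialSum_card, hs, ofNat_self]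
  · have h0 : ((i + 1 : Fin κ) : ℕ) = i + 1 := by
      rw [← ofNat_val_add_one, val_ofNat_of_lt (by have := i.2; omega)]
    rw [contactPos, h0]

theorem contactPos_add_one (s : Fin κ → ℕ) (hs : ∑ j, s j = n) (i : Fin κ) :
    contactPos n s (i + 1) = contactPos n s i + Fin.ofNat n (s (i + 1)) := by
  rw [← ofNat_partialSum_add_one s hs, partialSum_val_add_one, ofNat_add]; rfl

theorem contactPos_eq (s : Fin κ → ℕ) (hs : ∑ j, s j = n) (j : Fin κ) :
    contactPos n s j = contactPos n s (j - 1) + Fin.ofNat n (s j) := by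
  have := contactPos_add_one (n := n) s hs (j - 1)
  rwa [sub_add_cancel] at this

/-- Every boundary vector lies in a corner. -/
theorem exists_corner (s : Fin κ → ℕ) (hs : ∑ j, s j = n) {m : ℕ} (hm : m < n) :
    ∃ i : Fin κ, partialSum s i ≤ m ∧ m < partialSum s (i + 1 : ℕ) := by
  have hex : ∃ c, m < partialSum s c := ⟨κ, by rw [partialSum_card, hs]; exact hm⟩
  classical
  have h1 := Nat.find_spec hex
  have h2 : Nat.find hex ≤ κ := Nat.find_min' hex (by rw [partialSum_card, hs]; exact hm)
  obtain ⟨c, hc⟩ : ∃ c, Nat.find hex = c + 1 := by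
    refine Nat.exists_eq_succ_of_ne_zero fun h => ?_
    rw [h, partialSum_zero] at h1; omega
  refine ⟨⟨c, by omega⟩, ?_, by rw [← hc]; exact h1⟩
  exact not_lt.1 (Nat.find_min hex (m := c) (by omega))

/-- The admissibility condition forces every `s_j` to be smaller than `n`. -/
theorem size_lt (hκ : 3 ≤ κ) {s : Fin κ → ℕ} (hs : s ∈ sizeVectors κ n) (j : Fin κ) : s j < n := by
  obtain ⟨hs, h⟩ := hs
  have h1 := h (j + 1 + 1)
  rw [add_sub_cancel_right] at h1
  have hval : ∀ k : ℕ, 0 < k → k < κ → j + Fin.ofNat κ k ≠ j := by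
    intro k h0 hk he
    have : Fin.ofNat κ k = 0 := by simpa using he
    have := congrArg Fin.val this
    rw [val_ofNat_of_lt hk] at this
    simp at this; omega
  have n1 : j + 1 ≠ j := by simpa [ofNat_one] using hval 1 (by omega) (by omega)
  have n2 : j + 1 + 1 ≠ j := by
    have := hval 2 (by omega) (by omega)
    rwa [show (2 : ℕ) = 1 + 1 from rfl, ofNat_add, ofNat_one, ← add_assoc] at this
  have n3 : j + 1 + 1 ≠ j + 1 := by
    simpa [ofNat_one] using hval 1 (by omega) (by omega)
  have : s j + (s (j + 1) + s (j + 1 + 1)) ≤ ∑ i, s i := by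
    calc s j + (s (j + 1) + s (j + 1 + 1)) = ∑ i ∈ {j, j + 1, j + 1 + 1}, s i := by
          rw [Finset.sum_insert (by simp [n1.symm, n2.symm]), Finset.sum_pair n3.symm]
      _ ≤ _ := Finset.sum_le_sum_of_subset (Finset.subset_univ _)
  omega

theorem two_le_of_mem_sizeVectors (hκ : 3 ≤ κ) {s : Fin κ → ℕ} (hs : s ∈ sizeVectors κ n) :
    2 ≤ n := by
  have := size_lt hκ hs 0
  have h1 := size_lt hκ hs 1
  have h2 := size_lt hκ hs (1 - 1)
  have h3 := hs.2 1
  omega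

/-! ### Cross products, directions and arguments -/

/-- The determinant of two vectors of the plane. -/
def cross (a v : ℂ) : ℝ := ((starRingEnd ℂ) a * v).im

theorem cross_eq (a v : ℂ) : cross a v = a.re * v.im - a.im * v.re := by
  simp [cross]; ring

theorem cross_sub (a v w : ℂ) : cross a (v - w) = cross a v - cross a w := by
  simp [cross_eq]; ring

theorem cross_add (a v w : ℂ) : cross a (v + w) = cross a v + cross a w := by
  simp [cross_eq]; ring

theorem cross_ofReal_mul (a v : ℂ) (t : ℝ) : cross a (t * v) = t * cross a v := by
  simp [cross_eq]; ring

theorem cross_sum {ι : Type*} (a : ℂ) (f : ι → ℂ) (t : Finset ι) :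
    cross a (∑ i ∈ t, f i) = ∑ i ∈ t, cross a (f i) := by
  simp [cross, Finset.mul_sum]

theorem cross_comm (a b : ℂ) : cross a b = -cross b a := by simp [cross_eq]; ring

theorem obliqueCoord_eq (a e v : ℂ) : obliqueCoord a e v = cross a v / cross a e := rfl

theorem obliqueCoord_sub (a e v w : ℂ) :
    obliqueCoord a e (v - w) = obliqueCoord a e v - obliqueCoord a e w := by
  simp [obliqueCoord_eq, cross_sub, sub_div]

theorem obliqueCoord_add (a e v w : ℂ) :
    obliqueCoord a e (v + w) = obliqueCoord a e v + obliqueCoord a e w := by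
  simp [obliqueCoord_eq, cross_add, add_div]

theorem obliqueCoord_self {a e : ℂ} (h : cross a e ≠ 0) (t : ℝ) :
    obliqueCoord a e (t * e) = t := by
  rw [obliqueCoord_eq, cross_ofReal_mul, mul_div_assoc, div_self h, mul_one]

theorem height_sub_height (κ : ℕ) (j : Fin κ) (p q : ℂ) :
    height κ j p - height κ j q = cross (dir κ j) (p - q) := by
  rw [height, height, cross, ← Complex.sub_im]; congr 1; ring

/-- A vector orthogonal to the normal of `a` is a multiple of `a`. -/
theorem eq_ofReal_mul_of_cross_eq_zero {a v : ℂ} (ha : a ≠ 0) (h : cross a v = 0) :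
    ∃ t : ℝ, v = t * a := by
  refine ⟨((starRingEnd ℂ) a * v).re / Complex.normSq a, ?_⟩
  have h0 : (Complex.normSq a : ℂ) ≠ 0 := by simpa using ha
  have h1 : (starRingEnd ℂ) a * v = (((starRingEnd ℂ) a * v).re : ℂ) :=
    Complex.ext (by simp) (by simpa [cross] using h)
  have h2 : a * (starRingEnd ℂ) a = (Complex.normSq a : ℂ) := Complex.mul_conj a
  rw [Complex.ofReal_div, ← h1]
  field_simp
  linear_combination (-v) * h2

theorem eq_zero_of_cross_eq_zero {a b v : ℂ} (hab : cross a b ≠ 0) (ha : cross a v = 0)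
    (hb : cross b v = 0) : v = 0 := by
  have ha0 : a ≠ 0 := by rintro rfl; simp [cross_eq] at hab
  obtain ⟨t, rfl⟩ := eq_ofReal_mul_of_cross_eq_zero ha0 ha
  rw [cross_ofReal_mul, cross_comm] at hb
  have : t = 0 := by
    rcases mul_eq_zero.1 hb with h | h
    · exact h
    · exact absurd (neg_eq_zero.1 h) hab
  simp [this]

/-- The argument of the direction of the `c`-th side. -/
noncomputable def sideAngle (κ c : ℕ) : ℝ := 2 * Real.pi * c / κ

theorem sideAngle_zero (κ : ℕ) : sideAngle κ 0 = 0 := by simp [sideAngle]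

theorem sideAngle_self (κ : ℕ) [NeZero κ] : sideAngle κ κ = 2 * Real.pi := by
  have : (κ : ℝ) ≠ 0 := Nat.cast_ne_zero.2 (NeZero.ne κ)
  rw [sideAngle]; field_simp

theorem sideAngle_mono (κ : ℕ) : Monotone (sideAngle κ) := fun a b h => by
  have h' : (a : ℝ) ≤ b := Nat.cast_le.2 h
  have := Real.pi_pos
  unfold sideAngle
  gcongr

theorem sideAngle_nonneg (κ c : ℕ) : 0 ≤ sideAngle κ c := by
  rw [← sideAngle_zero κ]; exact sideAngle_mono κ (Nat.zero_le c)

theorem sideAngle_add_one (κ c : ℕ) : sideAngle κ (c + 1) = sideAngle κ c + 2 * Real.pi / κ := by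
  unfold sideAngle; push_cast; ring

theorem two_pi_div_lt_pi (hκ : 3 ≤ κ) : 2 * Real.pi / κ < Real.pi := by
  have h3 : (3 : ℝ) ≤ κ := by exact_mod_cast hκ
  rw [div_lt_iff₀ (by linarith)]
  nlinarith [Real.pi_pos]

theorem dir_eq (κ : ℕ) (j : Fin κ) : dir κ j = Complex.exp ((sideAngle κ j : ℂ) * Complex.I) := rfl

theorem dir_add_one_eq (j : Fin κ) :
    dir κ (j + 1) = Complex.exp ((sideAngle κ (j + 1 : ℕ) : ℂ) * Complex.I) := by
  rw [dir_add_one, dir_eq, ← Complex.exp_add, sideAngle_add_one]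
  push_cast; ring_nf

theorem dir_ne_zero (κ : ℕ) (j : Fin κ) : dir κ j ≠ 0 := Complex.exp_ne_zero _

theorem cross_exp_mul_exp (r φ a : ℝ) :
    cross (Complex.exp (φ * Complex.I)) (r * Complex.exp (a * Complex.I)) =
      r * Real.sin (a - φ) := by
  rw [cross_eq, Complex.im_ofReal_mul, Complex.re_ofReal_mul, Complex.exp_ofReal_mul_I_re,
    Complex.exp_ofReal_mul_I_im, Complex.exp_ofReal_mul_I_re, Complex.exp_ofReal_mul_I_im,
    Real.sin_sub]
  ring

theorem cross_dir_dir_add_one (j : Fin κ) :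
    cross (dir κ j) (dir κ (j + 1)) = Real.sin (theta κ) := by
  have := cross_exp_mul_exp 1 (sideAngle κ j) (sideAngle κ (j + 1 : ℕ))
  rw [Complex.ofReal_one, one_mul, one_mul, ← dir_eq, ← dir_add_one_eq] at this
  rw [this, sin_theta, sideAngle_add_one]; ring_nf

theorem cross_dir_add_one_dir (j : Fin κ) :
    cross (dir κ (j + 1)) (dir κ j) = -Real.sin (theta κ) := by
  rw [cross_comm, cross_dir_dir_add_one]

theorem angle_mem (v : ℂ) : 0 ≤ angle v ∧ angle v < 2 * Real.pi := by
  have := toIcoMod_mem_Ico Real.two_pi_pos 0 v.arg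
  rw [zero_add] at this
  exact this

theorem norm_mul_exp_angle (v : ℂ) : (‖v‖ : ℂ) * Complex.exp (angle v * Complex.I) = v := by
  obtain ⟨z, hz⟩ := ((toIcoMod_eq_iff Real.two_pi_pos (a := 0) (b := v.arg)).1 rfl).2
  have : ((angle v : ℝ) : ℂ) * Complex.I + z * (2 * Real.pi * Complex.I) = v.arg * Complex.I := by
    conv_rhs => rw [hz]
    rw [angle]; push_cast [zsmul_eq_mul]; ring
  conv_rhs => rw [← Complex.norm_mul_exp_arg_mul_I v]
  rw [← this, Complex.exp_add, Complex.exp_int_mul_two_pi_mul_I, mul_one]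

theorem cross_exp (φ : ℝ) (v : ℂ) :
    cross (Complex.exp (φ * Complex.I)) v = ‖v‖ * Real.sin (angle v - φ) := by
  conv_lhs => rw [← norm_mul_exp_angle v]
  exact cross_exp_mul_exp _ _ _

theorem cross_dir (j : Fin κ) (v : ℂ) :
    cross (dir κ j) v = ‖v‖ * Real.sin (angle v - sideAngle κ j) := cross_exp _ v

theorem cross_dir_add_one (j : Fin κ) (v : ℂ) :
    cross (dir κ (j + 1)) v = ‖v‖ * Real.sin (angle v - sideAngle κ (j + 1 : ℕ)) := by
  rw [dir_add_one_eq, cross_exp]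

/-- The coordinate of `v` along side `j + 1` in the basis of the directions of sides `j` and
`j + 1`. -/
theorem obliqueCoord_dir_dir_add_one (j : Fin κ) (v : ℂ) :
    obliqueCoord (dir κ j) (dir κ (j + 1)) v =
      ‖v‖ * Real.sin (angle v - sideAngle κ j) / Real.sin (theta κ) := by
  rw [obliqueCoord_eq, cross_dir, cross_dir_dir_add_one]

/-- The coordinate of `v` along side `j` in the basis of the directions of sides `j` and
`j + 1`. -/
theorem obliqueCoord_dir_add_one_dir (j : Fin κ) (v : ℂ) :
    obliqueCoord (dir κ (j + 1)) (dir κ j) v =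
      ‖v‖ * Real.sin (sideAngle κ (j + 1 : ℕ) - angle v) / Real.sin (theta κ) := by
  rw [obliqueCoord_eq, cross_dir_add_one, cross_dir_add_one_dir,
    show angle v - sideAngle κ (j + 1 : ℕ) = -(sideAngle κ (j + 1 : ℕ) - angle v) by ring,
    Real.sin_neg, mul_neg, neg_div_neg_eq]

/-! ### Closed polygons whose boundary vectors turn once -/

/-- The `m`-th boundary vector of the closed polygon `z`. -/
def edge (z : Fin n → ℂ) (m : Fin n) : ℂ := z (m + 1) - z m

theorem edge_ofNat (z : Fin n → ℂ) (m : ℕ) :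
    edge z (Fin.ofNat n m) = z (Fin.ofNat n (m + 1)) - z (Fin.ofNat n m) := by
  rw [edge, ofNat_add, ofNat_one]

theorem sum_edge_range (z : Fin n → ℂ) (M i : ℕ) :
    ∑ t ∈ Finset.range i, edge z (Fin.ofNat n (M + t)) =
      z (Fin.ofNat n (M + i)) - z (Fin.ofNat n M) := by
  simp_rw [edge_ofNat]
  exact Finset.sum_range_sub (fun t => z (Fin.ofNat n (M + t))) i

/-- The argument of the boundary vector with index `m` modulo `n`, increased by `2π` at each
turn. -/
noncomputable def liftedAngle (z : Fin n → ℂ) (m : ℕ) : ℝ :=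
  angle (edge z (Fin.ofNat n m)) + 2 * Real.pi * (m / n : ℕ)

theorem liftedAngle_of_lt (z : Fin n → ℂ) {m : ℕ} (hm : m < n) :
    liftedAngle z m = angle (edge z (Fin.ofNat n m)) := by
  simp [liftedAngle, Nat.div_eq_of_lt hm]

theorem liftedAngle_add_card (z : Fin n → ℂ) (m : ℕ) :
    liftedAngle z (m + n) = liftedAngle z m + 2 * Real.pi := by
  rw [liftedAngle, ofNat_add, ofNat_self, add_zero,
    Nat.add_div_right _ (Nat.pos_of_ne_zero (NeZero.ne n)), liftedAngle]
  push_cast; ring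

theorem strictMono_liftedAngle {z : Fin n → ℂ} (hz : StrictMono fun m => angle (edge z m)) :
    StrictMono (liftedAngle z) := by
  intro m m' h
  have hle : m / n ≤ m' / n := Nat.div_le_div_right h.le
  rcases hle.eq_or_lt with he | hlt
  · have : (Fin.ofNat n m) < Fin.ofNat n m' := by
      rw [Fin.lt_def]
      have h1 := Nat.div_add_mod m n
      have h2 := Nat.div_add_mod m' n
      simp only [Fin.ofNat]
      rw [he] at h1
      omega
    have := hz this
    simp only [liftedAngle, he]
    linarith
  · have h1 : ((m / n : ℕ) : ℝ) + 1 ≤ (m' / n : ℕ) := by exact_mod_cast hlt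
    have h2 := (angle_mem (edge z (Fin.ofNat n m))).2
    have h3 := (angle_mem (edge z (Fin.ofNat n m'))).1
    unfold liftedAngle
    nlinarith [Real.pi_pos]

theorem cross_exp_edge (z : Fin n → ℂ) (φ : ℝ) (m : ℕ) :
    cross (Complex.exp (φ * Complex.I)) (edge z (Fin.ofNat n m)) =
      ‖edge z (Fin.ofNat n m)‖ * Real.sin (liftedAngle z m - φ) := by
  rw [cross_exp, liftedAngle, show ∀ a b : ℝ, a + 2 * Real.pi * b - φ = a - φ + b * (2 * Real.pi) by
    intro a b; ring, Real.sin_add_nat_mul_two_pi]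

/-- If the arguments of the boundary vectors increase strictly and turn once, then the vertex at
which they pass the direction `φ` is the unique lowest one for the height over that direction:
starting there, the heights first increase and then decrease, and the total increment is zero. -/
theorem cross_pos_of_liftedAngle {z : Fin n → ℂ} (hz : StrictMono fun m => angle (edge z m))
    (hv : ∀ m, edge z m ≠ 0) {φ : ℝ} {M i : ℕ} (h1 : φ < liftedAngle z M)
    (h2 : liftedAngle z (M + (n - 1)) < φ + 2 * Real.pi) (hi : 0 < i) (hin : i < n) :
    0 < cross (Complex.exp (φ * Complex.I)) (z (Fin.ofNat n (M + i)) - z (Fin.ofNat n M)) := by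
  have hmono := strictMono_liftedAngle hz
  have hpos : ∀ m, 0 < ‖edge z m‖ := fun m => norm_pos_iff.2 (hv m)
  set g : ℕ → ℝ := fun t => ‖edge z (Fin.ofNat n (M + t))‖ * Real.sin (liftedAngle z (M + t) - φ)
    with hg
  have hsum : ∀ k, cross (Complex.exp (φ * Complex.I))
      (z (Fin.ofNat n (M + k)) - z (Fin.ofNat n M)) = ∑ t ∈ Finset.range k, g t := by
    intro k
    rw [← sum_edge_range, cross_sum]
    exact Finset.sum_congr rfl fun t _ => cross_exp_edge z φ (M + t)
  rw [hsum]
  obtain ⟨k, rfl⟩ := Nat.exists_eq_succ_of_ne_zero hi.ne'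
  -- as long as the argument is below `φ + π` all increments are positive; once it is not, all the
  -- remaining increments are negative
  by_cases hk : liftedAngle z (M + k) < φ + Real.pi
  · refine Finset.sum_pos (fun t ht => ?_) (by simp)
    have ht' := Finset.mem_range.1 ht
    have h3 : liftedAngle z (M + t) ≤ liftedAngle z (M + k) := hmono.monotone (by omega)
    have h4 : liftedAngle z M ≤ liftedAngle z (M + t) := hmono.monotone (by omega)
    exact mul_pos (hpos _) (Real.sin_pos_of_pos_of_lt_pi (by linarith) (by linarith))
  · have htot : ∑ t ∈ Finset.range n, g t = 0 := by
      rw [← hsum, ofNat_add, ofNat_self, add_zero, sub_self]; simp [cross]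
    rw [← Finset.sum_range_add_sum_Ico g hin.le] at htot
    have hneg : ∑ t ∈ Finset.Ico (k + 1) n, g t < 0 := by
      refine Finset.sum_neg (fun t ht => ?_) (by simpa using hin)
      have ht' := Finset.mem_Ico.1 ht
      have h3 : liftedAngle z (M + k) < liftedAngle z (M + t) := hmono (by omega)
      have h4 : liftedAngle z (M + t) ≤ liftedAngle z (M + (n - 1)) := hmono.monotone (by omega)
      refine mul_neg_of_pos_of_neg (hpos _) ?_
      rw [← Real.sin_sub_two_pi]
      exact Real.sin_neg_of_neg_of_neg_pi_lt (by linarith) (by linarith)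
    simp only [Nat.succ_eq_add_one]
    linarith

/-- A closed polygon whose boundary vectors have strictly increasing arguments is convex. -/
theorem convexIndependent_of_strictMono {z : Fin n → ℂ}
    (hz : StrictMono fun m => angle (edge z m)) (hv : ∀ m, edge z m ≠ 0) :
    ConvexIndependent ℝ z := by
  intro S x hx
  by_contra hxS
  have hmono := strictMono_liftedAngle hz
  have hn : 0 < n := Nat.pos_of_ne_zero (NeZero.ne n)
  -- a direction passed by the arguments at `z x`
  obtain ⟨φ, hφ1, hφ2⟩ : ∃ φ, liftedAngle z (x + (n - 1)) - 2 * Real.pi < φ ∧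
      φ < liftedAngle z x := by
    refine exists_between ?_
    have := hmono (show (x : ℕ) + (n - 1) < x + n by omega)
    rw [liftedAngle_add_card] at this
    linarith
  have key : z '' S ⊆ {p | 0 < cross (Complex.exp (φ * Complex.I)) (p - z x)} := by
    rintro _ ⟨y, hy, rfl⟩
    have hyx : y ≠ x := fun h => hxS (h ▸ hy)
    have hyx' : (y : ℕ) ≠ x := fun h => hyx (Fin.ext h)
    obtain ⟨i, hi, hin, hy'⟩ : ∃ i, 0 < i ∧ i < n ∧ Fin.ofNat n (x + i) = y := by
      rcases Nat.lt_or_gt_of_ne hyx' with h | h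
      · refine ⟨y + n - x, by omega, by omega, ?_⟩
        rw [show (x : ℕ) + (y + n - x) = y + n by omega, ofNat_add, ofNat_self, add_zero, ofNat_val]
      · exact ⟨y - x, by omega, by omega, by rw [show (x : ℕ) + (y - x) = y by omega, ofNat_val]⟩
    have := cross_pos_of_liftedAngle hz hv hφ2 (by linarith) hi hin
    rwa [hy', ofNat_val] at this
  have hconv : Convex ℝ {p : ℂ | 0 < cross (Complex.exp (φ * Complex.I)) (p - z x)} := by
    have : {p : ℂ | 0 < cross (Complex.exp (φ * Complex.I)) (p - z x)} =
        {p | cross (Complex.exp (φ * Complex.I)) (z x) <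
          cross (Complex.exp (φ * Complex.I)) p} := by
      ext p; simp [cross_sub]
    rw [this]
    refine convex_halfSpace_gt ⟨fun v w => cross_add _ v w, fun t v => ?_⟩ _
    rw [Complex.real_smul, cross_ofReal_mul, smul_eq_mul]
  have := convexHull_min key hconv hx
  simp [cross] at this

/-! ### Tuples whose boundary vectors lie in the prescribed corners -/

/-- The boundary vectors of `z` have strictly increasing arguments, and those with indices in
`[s_1 + ... + s_i, s_1 + ... + s_{i+1})` point strictly between the directions of the sides `i`
and `i + 1`. -/
structure IsCornerSorted (s : Fin κ → ℕ) (z : Fin n → ℂ) : Prop where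
  strictMono : StrictMono fun m => angle (edge z m)
  mem_corner : ∀ (i : Fin κ) (m : Fin n), partialSum s i ≤ m → (m : ℕ) < partialSum s (i + 1 : ℕ) →
    sideAngle κ i < angle (edge z m) ∧ angle (edge z m) < sideAngle κ (i + 1 : ℕ)

theorem angle_zero : angle 0 = 0 := by
  simp [angle]

section
variable {s : Fin κ → ℕ} {z : Fin n → ℂ}

theorem IsCornerSorted.lt_angle (h : IsCornerSorted s z) (hs : ∑ j, s j = n) (m : Fin n) {c : ℕ}
    (hm : partialSum s c ≤ m) : sideAngle κ c < angle (edge z m) := by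
  obtain ⟨i, h1, h2⟩ := exists_corner s hs m.2
  have hc : c ≤ i := by
    by_contra hlt
    have := partialSum_mono s (show (i + 1 : ℕ) ≤ c by omega)
    omega
  exact (sideAngle_mono κ hc).trans_lt (h.mem_corner i m h1 h2).1

theorem IsCornerSorted.angle_lt (h : IsCornerSorted s z) (hs : ∑ j, s j = n) (m : Fin n) {c : ℕ}
    (hm : (m : ℕ) < partialSum s c) : angle (edge z m) < sideAngle κ c := by
  obtain ⟨i, h1, h2⟩ := exists_corner s hs m.2
  have hc : (i + 1 : ℕ) ≤ c := by
    by_contra hlt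
    have := partialSum_mono s (show c ≤ i by omega)
    omega
  exact (h.mem_corner i m h1 h2).2.trans_le (sideAngle_mono κ hc)

theorem IsCornerSorted.edge_ne_zero (h : IsCornerSorted s z) (hs : ∑ j, s j = n) (m : Fin n) :
    edge z m ≠ 0 := by
  intro h0
  have := h.lt_angle hs m (c := 0) (by simp [partialSum_zero])
  rw [h0, angle_zero, sideAngle_zero] at this
  exact lt_irrefl _ this

/-- The point with index `contactPos n s j` is the unique closest one to the `j`-th side. -/
theorem IsCornerSorted.height_lt (h : IsCornerSorted s z) (hs : ∑ j, s j = n) (j : Fin κ)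
    {m : Fin n} (hm : m ≠ contactPos n s j) :
    height κ j (z (contactPos n s j)) < height κ j (z m) := by
  have hn : 0 < n := Nat.pos_of_ne_zero (NeZero.ne n)
  have hT : partialSum s j ≤ n := partialSum_le s hs j.2.le
  have hφ1 : sideAngle κ j < liftedAngle z (partialSum s j) := by
    rcases hT.eq_or_lt with he | hlt
    · have := liftedAngle_add_card z 0
      rw [zero_add, liftedAngle_of_lt z hn] at this
      have h1 := sideAngle_mono κ j.2.le
      have h2 := h.lt_angle hs (Fin.ofNat n 0) (c := 0) (by simp [partialSum_zero])
      rw [sideAngle_zero] at h2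
      rw [sideAngle_self] at h1
      rw [he]
      linarith
    · rw [liftedAngle_of_lt z hlt]
      exact h.lt_angle hs _ (by rw [val_ofNat_of_lt hlt])
  have hφ2 : liftedAngle z (partialSum s j + (n - 1)) < sideAngle κ j + 2 * Real.pi := by
    rcases Nat.eq_zero_or_pos (partialSum s j) with he | hlt
    · rw [he, zero_add, liftedAngle_of_lt z (by omega)]
      have := (angle_mem (edge z (Fin.ofNat n (n - 1)))).2
      linarith [sideAngle_nonneg κ j]
    · rw [show partialSum s j + (n - 1) = partialSum s j - 1 + n by omega, liftedAngle_add_card,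
        liftedAngle_of_lt z (by omega)]
      have := h.angle_lt hs (Fin.ofNat n (partialSum s j - 1)) (c := j)
        (by rw [val_ofNat_of_lt (by omega)]; omega)
      linarith
  have hne : m - contactPos n s j ≠ 0 := sub_ne_zero.2 hm
  have := cross_pos_of_liftedAngle h.strictMono (h.edge_ne_zero hs) hφ1 hφ2
    (i := (m - contactPos n s j : Fin n))
    (Nat.pos_of_ne_zero fun h0 => hne (Fin.ext (by simpa using h0))) (m - contactPos n s j).2
  rw [ofNat_add, ofNat_val] at this
  change 0 < cross _ (z (contactPos n s j + (m - contactPos n s j)) - z (contactPos n s j)) at this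
  rw [add_sub_cancel, ← dir_eq, ← height_sub_height] at this
  linarith

theorem IsCornerSorted.ell_eq (h : IsCornerSorted s z) (hs : ∑ j, s j = n) :
    ell κ z = fun j => height κ j (z (contactPos n s j)) := by
  funext j
  apply le_antisymm
  · exact ciInf_le (Set.finite_range fun i => height κ j (z i)).bddBelow _
  · refine le_ciInf fun m => ?_
    by_cases hm : m = contactPos n s j
    · rw [hm]
    · exact (h.height_lt hs j hm).le

theorem height_contactIndex (z : Fin n → ℂ) (j : Fin κ) :
    height κ j (z (contactIndex κ z j)) = ell κ z j :=
  (exists_contact κ z j).choose_spec.1.2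

theorem IsCornerSorted.contactIndex_eq (h : IsCornerSorted s z) (hs : ∑ j, s j = n) (j : Fin κ) :
    contactIndex κ z j = contactPos n s j := by
  by_contra hne
  have h1 := h.height_lt hs j hne
  rw [height_contactIndex, h.ell_eq hs] at h1
  exact lt_irrefl _ h1

theorem height_zero (p : ℂ) : height κ 0 p = p.im := by
  have : Finset.Iio (0 : Fin κ) = ∅ := by
    ext x; simp
  simp [height, dir, corner, this]

/-- A tuple with sorted boundary vectors in the interior of the regular polygon is a convex tuple
with the given size vector. -/
theorem IsCornerSorted.mem_convexTuplesOfSize (h : IsCornerSorted s z) (hκ : 3 ≤ κ)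
    (hs : s ∈ sizeVectors κ n) (hpos : ∀ j, 0 < height κ j (z (contactPos n s j))) :
    z ∈ convexTuplesOfSize κ n s := by
  refine ⟨⟨⟨convexIndependent_of_strictMono h.strictMono (h.edge_ne_zero hs.1), fun m => ?_,
    h.strictMono.monotone⟩, fun m j => ?_⟩, ?_⟩
  · by_cases hm : m = 0
    · right; simp [hm]
    · left
      have := h.height_lt hs.1 0 (m := m) (by rwa [contactPos_zero])
      rwa [contactPos_zero, height_zero, height_zero] at this
  · by_cases hm : m = contactPos n s j
    · rw [hm]; exact (hpos j).le
    · exact ((hpos j).trans (h.height_lt hs.1 j hm)).le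
  · funext j
    rw [sizeVector, h.contactIndex_eq hs.1, h.contactIndex_eq hs.1, contactPos_eq s hs.1 j,
      add_sub_cancel_left, val_ofNat_of_lt (size_lt hκ hs j)]

theorem height_contactIndex_le (z : Fin n → ℂ) (j : Fin κ) (m : Fin n) :
    height κ j (z (contactIndex κ z j)) ≤ height κ j (z m) := by
  rw [height_contactIndex]
  exact ciInf_le (Set.finite_range fun i => height κ j (z i)).bddBelow m

/-- The contact point of the bottom side is the first point of the tuple. -/
theorem contactIndex_zero (hz : IsCanonicalConvex z) : contactIndex κ z 0 = 0 := by
  obtain ⟨hci, hlow, -⟩ := hz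
  have hmin := height_contactIndex_le (κ := κ) z 0
  have him : (z 0).im ≤ (z (contactIndex κ z 0)).im := by
    rcases hlow (contactIndex κ z 0) with h | h
    · exact h.le
    · exact h.1.le
  have him' : (z (contactIndex κ z 0)).im = (z 0).im := by
    refine le_antisymm ?_ him
    simpa [height_zero] using hmin 0
  have h0 : z 0 ∈ ecpSide κ z 0 := by
    refine ⟨mem_iInter₂.2 fun t ht => ht 0, ?_⟩
    rw [← height_contactIndex, height_zero, height_zero, him']
  have hlex := (exists_contact κ z 0).choose_spec.2 0 h0
  change toLex ((z (contactIndex κ z 0)).re, (z (contactIndex κ z 0)).im) ≤ _ at hlex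
  rw [Prod.Lex.le_iff] at hlex
  have hre : (z (contactIndex κ z 0)).re ≤ (z 0).re := by
    rcases hlex with h | h
    · exact le_of_lt h
    · exact le_of_eq h.1
  refine hci.injective (Complex.ext (le_antisymm hre ?_) him')
  rcases hlow (contactIndex κ z 0) with h | h
  · exact absurd him' h.ne'
  · exact h.2

/-- The size vector determines the contact points, starting from that of the bottom side. -/
theorem contactIndex_eq_of_mem (hs : ∑ j, s j = n) (hz : z ∈ convexTuplesOfSize κ n s)
    (j : Fin κ) : contactIndex κ z j = contactPos n s j := by
  have hstep : ∀ j, contactIndex κ z j = contactIndex κ z (j - 1) + Fin.ofNat n (s j) := by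
    intro j
    rw [← hz.2, sizeVector, ofNat_val, add_sub_cancel]
  have : ∀ c : ℕ, contactIndex κ z (Fin.ofNat κ c) = contactPos n s (Fin.ofNat κ c) := by
    intro c
    induction c with
    | zero => rw [ofNat_zero, contactPos_zero, contactIndex_zero hz.1.1]
    | succ c ih =>
      rw [hstep, contactPos_eq s hs, ofNat_add, ofNat_one, add_sub_cancel_right, ih]
  rw [← ofNat_val j, this]

/-- Two successive corners contain at least one boundary vector. -/
theorem partialSum_lt_add_two (hs : s ∈ sizeVectors κ n) (c : ℕ) :
    partialSum s c < partialSum s (c + 2) := by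
  have := hs.2 (Fin.ofNat κ (c + 1 + 1))
  rw [ofNat_add κ (c + 1), ofNat_one, add_sub_cancel_right] at this
  have h2 : partialSum s (c + 2) = partialSum s c + s (Fin.ofNat κ (c + 1)) +
      s (Fin.ofNat κ (c + 1) + 1) := by
    rw [partialSum, Finset.sum_range_succ, Finset.sum_range_succ, ofNat_add κ (c + 1) 1, ofNat_one]
    rfl
  omega

theorem lt_or_lt_of_sin_pos {x : ℝ} (h2 : x ≤ 2 * Real.pi)
    (h : 0 < Real.sin x) : 0 < x ∧ x < Real.pi ∨ x < -Real.pi := by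
  by_contra! hc
  rcases le_or_gt x 0 with hx | hx
  · exact absurd (Real.sin_nonpos_of_nonpos_of_neg_pi_le hx (hc.2)) (not_le.2 h)
  · have h3 := Real.sin_nonpos_of_nonpos_of_neg_pi_le (x := x - 2 * Real.pi) (by linarith)
      (by linarith [hc.1 hx])
    rw [Real.sin_sub_two_pi] at h3
    linarith

/-- In a generic convex tuple, the boundary vectors before the `j`-th contact point have arguments
smaller than that of the `j`-th side, the other ones have larger arguments. -/
theorem angle_lt_and_lt_angle (hκ : 3 ≤ κ) (hs : s ∈ sizeVectors κ n)
    (hz : z ∈ convexTuplesOfSize κ n s)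
    (hgen : ∀ (j : Fin κ) (m : Fin n), cross (dir κ j) (edge z m) ≠ 0) (j : Fin κ) (m : Fin n) :
    ((m : ℕ) < partialSum s j → angle (edge z m) < sideAngle κ j) ∧
      (partialSum s j ≤ m → sideAngle κ j < angle (edge z m)) := by
  have hmon : Monotone fun m => angle (edge z m) := hz.1.1.2.2
  have hT : partialSum s j ≤ n := partialSum_le s hs.1 j.2.le
  have hmin : ∀ m, height κ j (z (contactPos n s j)) ≤ height κ j (z m) := by
    intro m
    rw [← contactIndex_eq_of_mem hs.1 hz]
    exact height_contactIndex_le z j m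
  have hφ0 := sideAngle_nonneg κ j
  have hφ2 : sideAngle κ j + 2 * Real.pi / κ ≤ 2 * Real.pi := by
    rw [← sideAngle_add_one, ← sideAngle_self κ]
    exact sideAngle_mono κ j.2
  have hst : 0 < 2 * Real.pi / κ := by
    have := Real.pi_pos
    have : (0 : ℝ) < κ := Nat.cast_pos.2 (by omega)
    positivity
  have hstep := two_pi_div_lt_pi hκ
  -- the boundary vector leaving the contact point goes up, the one arriving there goes down
  have hout : 0 < Real.sin (angle (edge z (contactPos n s j)) - sideAngle κ j) := by
    have h1 : 0 ≤ cross (dir κ j) (edge z (contactPos n s j)) := by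
      rw [edge, ← height_sub_height]
      linarith [hmin (contactPos n s j + 1)]
    have h2 := lt_of_le_of_ne h1 (hgen j _).symm
    rw [cross_dir] at h2
    exact pos_of_mul_pos_right h2 (norm_nonneg _)
  have hin : 0 < Real.sin (sideAngle κ j - angle (edge z (contactPos n s j - 1))) := by
    have h1 : cross (dir κ j) (edge z (contactPos n s j - 1)) ≤ 0 := by
      rw [edge, ← height_sub_height, sub_add_cancel]
      linarith [hmin (contactPos n s j - 1)]
    have h2 := lt_of_le_of_ne h1 (hgen j _)
    rw [cross_dir, ← neg_pos, ← mul_neg, ← Real.sin_neg, neg_sub] at h2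
    exact pos_of_mul_pos_right h2 (norm_nonneg _)
  have ha := angle_mem (edge z (contactPos n s j))
  have hb := angle_mem (edge z (contactPos n s j - 1))
  have hout' := lt_or_lt_of_sin_pos (by linarith) hout
  have hin' := lt_or_lt_of_sin_pos (by linarith) hin
  have hn : 0 < n := Nat.pos_of_ne_zero (NeZero.ne n)
  rcases Nat.eq_zero_or_pos (partialSum s j) with h0 | hpos
  -- no boundary vector before the contact point: this forces `j ≤ 1`, so `sideAngle κ j < π`
  · refine ⟨fun h => by omega, fun _ => ?_⟩
    have hK : contactPos n s j = 0 := by rw [contactPos, h0, ofNat_zero]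
    have hj : (j : ℕ) ≤ 1 := by
      by_contra hlt
      have h1 := partialSum_lt_add_two hs 0
      have h2 := partialSum_mono s (show 0 + 2 ≤ (j : ℕ) by omega)
      omega
    have hφ : sideAngle κ j < Real.pi := by
      have := sideAngle_mono κ hj
      have h1 := sideAngle_add_one κ 0
      rw [sideAngle_zero, zero_add, zero_add] at h1
      linarith
    have : angle (edge z 0) ≤ angle (edge z m) := hmon (Fin.zero_le m)
    rw [hK] at hout' ha
    rcases hout' with h | h <;> linarith
  · have hK1 : contactPos n s j - 1 = Fin.ofNat n (partialSum s j - 1) := by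
      rw [sub_eq_iff_eq_add, ← ofNat_one n, ← ofNat_add, Nat.sub_add_cancel hpos]; rfl
    rcases hT.eq_or_lt with hTn | hTn
    -- all boundary vectors before it: this forces `j = κ - 1`, so `sideAngle κ j > π`
    · refine ⟨fun _ => ?_, fun h => by have := m.2; omega⟩
      have hj : κ ≤ (j + 1 : ℕ) := by
        by_contra hlt
        have h1 := partialSum_lt_add_two hs j
        have h2 := partialSum_le s hs.1 (show (j + 2 : ℕ) ≤ κ by omega)
        omega
      have hφ : Real.pi < sideAngle κ j := by
        have := sideAngle_mono κ hj
        rw [sideAngle_self, sideAngle_add_one] at this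
        linarith
      have : angle (edge z m) ≤ angle (edge z (contactPos n s j - 1)) := by
        refine hmon ?_
        rw [hK1, Fin.le_def, val_ofNat_of_lt (by omega)]
        have := m.2
        omega
      rcases hin' with h | h <;> linarith
    · have hle : angle (edge z (contactPos n s j - 1)) ≤ angle (edge z (contactPos n s j)) := by
        refine hmon ?_
        rw [hK1, contactPos, Fin.le_def, val_ofNat_of_lt (by omega), val_ofNat_of_lt hTn]
        omega
      constructor
      · intro h
        have : angle (edge z m) ≤ angle (edge z (contactPos n s j - 1)) := by
          refine hmon ?_
          rw [hK1, Fin.le_def, val_ofNat_of_lt (by omega)]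
          omega
        rcases hin' with h | h <;> rcases hout' with h' | h' <;> linarith
      · intro h
        have : angle (edge z (contactPos n s j)) ≤ angle (edge z m) := by
          refine hmon ?_
          rw [contactPos, Fin.le_def, val_ofNat_of_lt hTn]
          exact h
        rcases hin' with h | h <;> rcases hout' with h' | h' <;> linarith

/-- Two successive boundary vectors of a convex polygon are not parallel and of the same
direction. -/
theorem angle_edge_ne (hn : 2 ≤ n) (hci : ConvexIndependent ℝ z) (m : Fin n) :
    angle (edge z m) ≠ angle (edge z (m + 1)) := by
  intro he
  have h1 : (1 : Fin n) ≠ 0 := by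
    intro h
    have := congrArg Fin.val h
    rw [← ofNat_one, val_ofNat_of_lt hn] at this
    simp at this
  have hne : ∀ m, 0 < ‖edge z m‖ := by
    intro m
    refine norm_pos_iff.2 (sub_ne_zero.2 fun h => h1 ?_)
    simpa using hci.injective h
  set r := ‖edge z m‖ with hr
  set r' := ‖edge z (m + 1)‖ with hr'
  have hr0 : 0 < r := hne m
  have hr0' : 0 < r' := hne (m + 1)
  have hpar : (r' : ℂ) * edge z m = r * edge z (m + 1) := by
    rw [← norm_mul_exp_angle (edge z m), ← norm_mul_exp_angle (edge z (m + 1)), ← hr, ← hr', he]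
    ring
  have hC : ((r + r' : ℝ) : ℂ) ≠ 0 := by exact_mod_cast (add_pos hr0 hr0').ne'
  have hmem : z (m + 1) ∈ convexHull ℝ (z '' {m, m + 1 + 1}) := by
    refine segment_subset_convexHull (mem_image_of_mem z (by simp : m ∈ _))
      (mem_image_of_mem z (by simp : m + 1 + 1 ∈ _))
      ⟨r' / (r + r'), r / (r + r'), by positivity, by positivity, by field_simp; ring, ?_⟩
    rw [Complex.real_smul, Complex.real_smul, Complex.ofReal_div, Complex.ofReal_div]
    simp only [edge] at hpar
    field_simp
    push_cast
    linear_combination -hpar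
  have := hci _ _ hmem
  simp [h1] at this

/-- A convex tuple without boundary vector parallel to a side has its boundary vectors sorted in
the corners prescribed by its size vector. -/
theorem isCornerSorted_of_mem (hκ : 3 ≤ κ) (hs : s ∈ sizeVectors κ n)
    (hz : z ∈ convexTuplesOfSize κ n s)
    (hgen : ∀ (j : Fin κ) (m : Fin n), cross (dir κ j) (edge z m) ≠ 0) :
    IsCornerSorted s z := by
  have hmon : Monotone fun m => angle (edge z m) := hz.1.1.2.2
  refine ⟨hmon.strictMono_of_injective ?_, fun i m h1 h2 => ⟨?_, ?_⟩⟩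
  · have key : ∀ m m' : Fin n, m < m' → angle (edge z m) ≠ angle (edge z m') := by
      intro m m' hlt he
      have hlt' := Fin.lt_def.1 hlt
      have hm' := m'.2
      have h1 : ((m + 1 : Fin n) : ℕ) = m + 1 := by
        rw [← ofNat_val_add_one, val_ofNat_of_lt (by omega)]
      refine angle_edge_ne (two_le_of_mem_sizeVectors hκ hs) hz.1.1.1 m (le_antisymm ?_ ?_)
      · exact hmon (by rw [Fin.le_def, h1]; omega)
      · rw [he]
        exact hmon (by rw [Fin.le_def, h1]; omega)
    intro m m' he
    rcases lt_trichotomy m m' with h | h | h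
    · exact absurd he (key m m' h)
    · exact h
    · exact absurd he.symm (key m' m h)
  · exact (angle_lt_and_lt_angle hκ hs hz hgen i m).2 h1
  · rcases eq_or_ne (i + 1 : ℕ) κ with h | h
    · rw [h, sideAngle_self]
      exact (angle_mem _).2
    · have := (angle_lt_and_lt_angle hκ hs hz hgen (Fin.ofNat κ (i + 1)) m).1
      rw [val_ofNat_of_lt (by have := i.2; omega)] at this
      exact this h2

end

/-! ### The extraction map with prescribed contact points -/

/-- The distances to the side lines of the points with indices `contactPos n s j`. -/
noncomputable def contactHeight (s : Fin κ → ℕ) (z : Fin n → ℂ) (j : Fin κ) : ℝ :=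
  height κ j (z (contactPos n s j))

/-- The affine map given by the formulas that define `chi`, the `j`-th contact point being
replaced by the point with index `contactPos n s j`. -/
noncomputable def affineChi (n : ℕ) [NeZero n] (s : Fin κ → ℕ) (z : Fin n → ℂ) : ParamSpace s :=
  (contactHeight s z, fun j i =>
    if (i : ℕ) + 1 ≤ s j then
      obliqueCoord (dir κ (j - 1)) (dir κ j)
        (z (contactPos n s (j - 1) + Fin.ofNat n (i + 1)) - ecpVertex κ (contactHeight s z) j)
    else
      obliqueCoord (dir κ (j + 1)) (dir κ j)
        (z (contactPos n s (j - 1) + Fin.ofNat n (i + 1)) - ecpVertex κ (contactHeight s z) j))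

theorem IsCornerSorted.chi_eq {s : Fin κ → ℕ} {z : Fin n → ℂ} (h : IsCornerSorted s z)
    (hs : ∑ j, s j = n) : chi κ n s z = affineChi n s z := by
  have h1 : ell κ z = contactHeight s z := h.ell_eq hs
  refine Prod.ext h1 ?_
  funext j i
  simp only [chi, sidePartition, affineChi, h.contactIndex_eq hs, h1]

section
variable {s : Fin κ → ℕ} (z : Fin n → ℂ) (j : Fin κ)

theorem cross_contact_sub_vertex (hκ : 3 ≤ κ) :
    cross (dir κ j) (z (contactPos n s j) - ecpVertex κ (contactHeight s z) j) = 0 := by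
  rw [← height_sub_height, (height_ecpVertex hκ _ j).2, contactHeight, sub_self]

theorem cross_contact_sub_vertex' (hκ : 3 ≤ κ) :
    cross (dir κ (j - 1)) (z (contactPos n s (j - 1)) - ecpVertex κ (contactHeight s z) j) = 0 := by
  rw [← height_sub_height, (height_ecpVertex hκ _ j).1, contactHeight, sub_self]

theorem cross_dir_sub_one_dir : cross (dir κ (j - 1)) (dir κ j) = Real.sin (theta κ) := by
  have := cross_dir_dir_add_one (j - 1)
  rwa [sub_add_cancel] at this

theorem contactPos_eq_of_size_eq_zero (hs : ∑ j, s j = n) (h0 : s j = 0) :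
    contactPos n s j = contactPos n s (j - 1) := by
  rw [contactPos_eq s hs, h0, ofNat_zero, add_zero]

/-- When two successive contact points coincide, they are a vertex of the circumscribed polygon. -/
theorem contact_eq_vertex (hκ : 3 ≤ κ) (hs : ∑ j, s j = n) (h0 : s j = 0) :
    z (contactPos n s j) = ecpVertex κ (contactHeight s z) j := by
  have h1 := cross_contact_sub_vertex (s := s) z j hκ
  have h2 := cross_contact_sub_vertex' (s := s) z j hκ
  rw [← contactPos_eq_of_size_eq_zero j hs h0] at h2
  refine sub_eq_zero.1 (eq_zero_of_cross_eq_zero ?_ h2 h1)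
  rw [cross_dir_sub_one_dir]
  exact (sin_theta_pos hκ).ne'

theorem extend_zero (c : ℝ) {k : ℕ} (a : Fin k → ℝ) : extend c a 0 = 0 := by simp [extend]

theorem extend_add_one (c : ℝ) {k : ℕ} (a : Fin k → ℝ) {i : ℕ} (h : i < k) :
    extend c a (i + 1) = a ⟨i, h⟩ := by simp [extend, h]

theorem extend_last (c : ℝ) {k : ℕ} (a : Fin k → ℝ) : extend c a (k + 1) = c := by simp [extend]

/-- The first half of the extended side-partition consists of the coordinates of the points of the
corner `j` along its second side. -/
theorem extend_affineChi_left (hκ : 3 ≤ κ) (hs : s ∈ sizeVectors κ n) {k : ℕ} (hk : k ≤ s j) :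
    extend (sideLength κ (contactHeight s z) j) ((affineChi n s z).2 j) k =
      obliqueCoord (dir κ (j - 1)) (dir κ j)
        (z (contactPos n s (j - 1) + Fin.ofNat n k) - ecpVertex κ (contactHeight s z) j) := by
  have hS := (sin_theta_pos hκ).ne'
  rcases k with _ | k
  · rw [extend_zero, ofNat_zero, add_zero, obliqueCoord_eq, cross_contact_sub_vertex' z j hκ,
      zero_div]
  · by_cases hlt : k < numPart s j
    · rw [extend_add_one _ _ hlt]
      simp only [affineChi, hk, if_true]
    · have h0 : s (j + 1) = 0 := by unfold numPart at hlt; omega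
      have hk' : k + 1 = s j := by unfold numPart at hlt; omega
      have hN : k = numPart s j := by unfold numPart at hlt ⊢; omega
      have hv := contact_eq_vertex z (j + 1) hκ hs.1 h0
      rw [contactPos_eq_of_size_eq_zero _ hs.1 h0, add_sub_cancel_right] at hv
      rw [hk', ← contactPos_eq s hs.1, hv, ecpVertex_sub hκ, obliqueCoord_self]
      · rw [← hk', hN, extend_last]
      · rw [cross_dir_sub_one_dir]; exact hS

/-- The second half of the extended side-partition consists of the coordinates of the points of the
corner `j + 1` along its first side. -/
theorem extend_affineChi_right (hκ : 3 ≤ κ) (hs : s ∈ sizeVectors κ n) {k : ℕ}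
    (hk : k ≤ s (j + 1)) :
    extend (sideLength κ (contactHeight s z) j) ((affineChi n s z).2 j) (s j + k) =
      obliqueCoord (dir κ (j + 1)) (dir κ j)
        (z (contactPos n s j + Fin.ofNat n k) - ecpVertex κ (contactHeight s z) j) := by
  have hS := (sin_theta_pos hκ).ne'
  have hS1 : cross (dir κ (j - 1)) (dir κ j) ≠ 0 := by rwa [cross_dir_sub_one_dir]
  have hS2 : cross (dir κ (j + 1)) (dir κ j) ≠ 0 := by
    rw [cross_dir_add_one_dir]; exact neg_ne_zero.2 hS
  rcases k with _ | k
  · -- the contact point lies on the side, so both projections fix it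
    rw [add_zero, extend_affineChi_left z j hκ hs le_rfl, ← contactPos_eq s hs.1, ofNat_zero,
      add_zero]
    obtain ⟨t, ht⟩ := eq_ofReal_mul_of_cross_eq_zero (dir_ne_zero κ j)
      (cross_contact_sub_vertex (s := s) z j hκ)
    rw [ht, obliqueCoord_self hS1, obliqueCoord_self hS2]
  · by_cases hlt : s j + k < numPart s j
    · rw [← add_assoc, extend_add_one _ _ hlt]
      simp only [affineChi]
      rw [if_neg (by omega), add_assoc, ofNat_add n (s j), ← add_assoc, ← contactPos_eq s hs.1]
    · have hk' : k + 1 = s (j + 1) := by unfold numPart at hlt; omega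
      have hN : s j + k = numPart s j := by unfold numPart at hlt ⊢; omega
      have h1 := cross_contact_sub_vertex (s := s) z (j + 1) hκ
      rw [← add_assoc, hN, extend_last, hk', ← contactPos_add_one s hs.1,
        ← sub_add_sub_cancel _ (ecpVertex κ (contactHeight s z) (j + 1)), ecpVertex_sub hκ,
        obliqueCoord_add, obliqueCoord_self hS2, obliqueCoord_eq, h1, zero_div, zero_add]

theorem incr_affineChi_left (hκ : 3 ≤ κ) (hs : s ∈ sizeVectors κ n) {k : ℕ} (hk : k + 1 ≤ s j) :
    incr (sideLength κ (contactHeight s z) j) ((affineChi n s z).2 j) (k + 1) =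
      obliqueCoord (dir κ (j - 1)) (dir κ j)
        (edge z (contactPos n s (j - 1) + Fin.ofNat n k)) := by
  rw [incr, add_tsub_cancel_right, extend_affineChi_left z j hκ hs hk,
    extend_affineChi_left z j hκ hs (by omega), ← obliqueCoord_sub, sub_sub_sub_cancel_right,
    edge, add_assoc, ← ofNat_one n, ← ofNat_add]

theorem incr_affineChi_right (hκ : 3 ≤ κ) (hs : s ∈ sizeVectors κ n) {k : ℕ}
    (hk : k + 1 ≤ s (j + 1)) :
    incr (sideLength κ (contactHeight s z) j) ((affineChi n s z).2 j) (s j + (k + 1)) =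
      obliqueCoord (dir κ (j + 1)) (dir κ j) (edge z (contactPos n s j + Fin.ofNat n k)) := by
  rw [incr, extend_affineChi_right z j hκ hs hk, ← add_assoc, add_tsub_cancel_right,
    extend_affineChi_right z j hκ hs (by omega), ← obliqueCoord_sub, sub_sub_sub_cancel_right,
    edge, add_assoc, ← ofNat_one n, ← ofNat_add]

end

/-! ### Points of the simplex and their increments -/

theorem sum_incr (c : ℝ) {k : ℕ} (a : Fin k → ℝ) (i : ℕ) :
    ∑ t ∈ Finset.range i, incr c a (t + 1) = extend c a i := by
  simp only [incr, add_tsub_cancel_right]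
  rw [Finset.sum_range_sub, extend_zero, sub_zero]

theorem incr_pos {c : ℝ} {k : ℕ} {a : Fin k → ℝ} (ha : a ∈ simplexP c k) (hc : 0 < c) {i : ℕ}
    (hi : i < k + 1) : 0 < incr c a (i + 1) := by
  rw [incr, add_tsub_cancel_right, sub_pos]
  rcases i with _ | i
  · rw [extend_zero]
    rcases Nat.eq_zero_or_pos k with rfl | hk
    · rwa [extend_last]
    · rw [extend_add_one _ _ hk]; exact (ha.2 _).1
  · rw [extend_add_one _ _ (show i < k by omega)]
    rcases (show i + 1 ≤ k by omega).eq_or_lt with h | h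
    · rw [h, extend_last]; exact (ha.2 _).2
    · rw [extend_add_one _ _ h]; exact ha.1 (by simp)

theorem mem_simplexP_of_incr_pos {c : ℝ} {k : ℕ} {a : Fin k → ℝ}
    (h : ∀ i < k + 1, 0 < incr c a (i + 1)) : a ∈ simplexP c k ∧ 0 < c := by
  have key : ∀ i i', i < i' → i' ≤ k + 1 → extend c a i < extend c a i' := by
    intro i i' hlt hle
    rw [← sum_incr, ← sum_incr, ← Finset.sum_range_add_sum_Ico _ hlt.le]
    refine lt_add_of_pos_right _ (Finset.sum_pos (fun t ht => h t ?_) (by simpa using hlt))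
    have := (Finset.mem_Ico.1 ht).2
    omega
  refine ⟨⟨fun i i' hlt => ?_, fun i => ⟨?_, ?_⟩⟩, ?_⟩
  · have := key (i + 1) (i' + 1) (by rw [Fin.lt_def] at hlt; omega) (by have := i'.2; omega)
    rwa [extend_add_one _ _ i.2, extend_add_one _ _ i'.2] at this
  · have := key 0 (i + 1) (by omega) (by have := i.2; omega)
    rwa [extend_add_one _ _ i.2, extend_zero] at this
  · have := key (i + 1) (k + 1) (by have := i.2; omega) le_rfl
    rwa [extend_add_one _ _ i.2, extend_last] at this
  · have := key 0 (k + 1) (by omega) le_rfl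
    rwa [extend_last, extend_zero] at this

/-! ### Parameters of corner-sorted tuples -/

theorem lt_and_lt_of_sin_pos {a φ φ' : ℝ} (ha0 : 0 ≤ a) (ha : a ≤ 2 * Real.pi) (hφ : 0 ≤ φ)
    (hφ' : φ' ≤ 2 * Real.pi) (hlt : φ < φ') (hpi : φ' < φ + Real.pi)
    (h1 : 0 < Real.sin (a - φ)) (h2 : 0 < Real.sin (φ' - a)) : φ < a ∧ a < φ' := by
  rcases lt_or_lt_of_sin_pos (by linarith) h1 with h | h <;>
  rcases lt_or_lt_of_sin_pos (by linarith) h2 with h' | h' <;> constructor <;> linarith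

/-- The slope of a vector in the basis of two directions increases with its argument. -/
theorem sin_div_sin_lt_iff {a a' φ φ' : ℝ} (hpi : φ' < φ + Real.pi) (h1 : φ < a) (h2 : a < φ')
    (h1' : φ < a') (h2' : a' < φ') :
    Real.sin (a - φ) / Real.sin (φ' - a) < Real.sin (a' - φ) / Real.sin (φ' - a') ↔ a < a' := by
  have p1 : 0 < Real.sin (φ' - a) := Real.sin_pos_of_pos_of_lt_pi (by linarith) (by linarith)
  have p2 : 0 < Real.sin (φ' - a') := Real.sin_pos_of_pos_of_lt_pi (by linarith) (by linarith)
  have p3 : 0 < Real.sin (φ' - φ) := Real.sin_pos_of_pos_of_lt_pi (by linarith) (by linarith)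
  have key : Real.sin (a' - φ) * Real.sin (φ' - a) - Real.sin (a - φ) * Real.sin (φ' - a') =
      Real.sin (a' - a) * Real.sin (φ' - φ) := by
    simp only [Real.sin_sub]
    ring
  rw [div_lt_div_iff₀ p1 p2, ← sub_pos, key, mul_pos_iff_of_pos_right p3]
  constructor
  · intro h
    rcases lt_or_lt_of_sin_pos (by linarith) h with h | h <;> linarith
  · intro h
    exact Real.sin_pos_of_pos_of_lt_pi (by linarith) (by linarith)

/-- The slope condition of `paramSet`, indexed by the first side of the corner instead of the
second one. -/
theorem strictMonoOn_ratio_iff {s : Fin κ → ℕ} (x : ParamSpace s) :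
    (∀ j, StrictMonoOn
      (fun k : ℕ => incr (sideLength κ x.1 j) (x.2 j) k /
        incr (sideLength κ x.1 (j - 1)) (x.2 (j - 1)) (s (j - 1) + k))
      (Set.Icc 1 (s j))) ↔
    ∀ i, StrictMonoOn
      (fun k : ℕ => incr (sideLength κ x.1 (i + 1)) (x.2 (i + 1)) k /
        incr (sideLength κ x.1 i) (x.2 i) (s i + k))
      (Set.Icc 1 (s (i + 1))) := by
  have key : ∀ j i, i = j - 1 → j = i + 1 → ((StrictMonoOn
      (fun k : ℕ => incr (sideLength κ x.1 j) (x.2 j) k /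
        incr (sideLength κ x.1 (j - 1)) (x.2 (j - 1)) (s (j - 1) + k))
      (Set.Icc 1 (s j))) ↔ StrictMonoOn
      (fun k : ℕ => incr (sideLength κ x.1 (i + 1)) (x.2 (i + 1)) k /
        incr (sideLength κ x.1 i) (x.2 i) (s i + k))
      (Set.Icc 1 (s (i + 1)))) := by
    rintro j i h rfl
    rw [← h]
  exact ⟨fun h i => (key (i + 1) i (by simp) rfl).1 (h _),
    fun h j => (key j (j - 1) rfl (by simp)).2 (h _)⟩

/-- The part of `paramSet` where all distances to the side lines are positive. -/
def openParamSet (κ : ℕ) [NeZero κ] (s : Fin κ → ℕ) : Set (ParamSpace s) :=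
  {x | x ∈ paramSet κ s ∧ ∀ j, 0 < x.1 j}

section
variable {s : Fin κ → ℕ} {z : Fin n → ℂ}

theorem sideAngle_val_lt (hκ : 3 ≤ κ) (i : Fin κ) :
    sideAngle κ i < sideAngle κ (i + 1 : ℕ) ∧ sideAngle κ (i + 1 : ℕ) < sideAngle κ i + Real.pi ∧
      sideAngle κ (i + 1 : ℕ) ≤ 2 * Real.pi := by
  have := Real.pi_pos
  have h0 : (0 : ℝ) < κ := Nat.cast_pos.2 (by omega)
  have h1 : 0 < 2 * Real.pi / κ := by positivity
  refine ⟨?_, ?_, ?_⟩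
  · rw [sideAngle_add_one]; linarith
  · rw [sideAngle_add_one]; linarith [two_pi_div_lt_pi hκ]
  · rw [← sideAngle_self κ]; exact sideAngle_mono κ i.2

theorem incr_affineChi_second (hκ : 3 ≤ κ) (hs : s ∈ sizeVectors κ n) (z : Fin n → ℂ) (i : Fin κ)
    {k : ℕ} (hk : k < s (i + 1)) :
    incr (sideLength κ (contactHeight s z) (i + 1)) ((affineChi n s z).2 (i + 1)) (k + 1) =
      ‖edge z (contactPos n s i + Fin.ofNat n k)‖ *
        Real.sin (angle (edge z (contactPos n s i + Fin.ofNat n k)) - sideAngle κ i) /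
        Real.sin (theta κ) := by
  rw [incr_affineChi_left z _ hκ hs hk, add_sub_cancel_right, obliqueCoord_dir_dir_add_one]

theorem incr_affineChi_first (hκ : 3 ≤ κ) (hs : s ∈ sizeVectors κ n) (z : Fin n → ℂ) (i : Fin κ)
    {k : ℕ} (hk : k < s (i + 1)) :
    incr (sideLength κ (contactHeight s z) i) ((affineChi n s z).2 i) (s i + (k + 1)) =
      ‖edge z (contactPos n s i + Fin.ofNat n k)‖ *
        Real.sin (sideAngle κ (i + 1 : ℕ) - angle (edge z (contactPos n s i + Fin.ofNat n k))) /
        Real.sin (theta κ) := by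
  rw [incr_affineChi_right z _ hκ hs hk, obliqueCoord_dir_add_one_dir]

theorem incr_div_incr (hκ : 3 ≤ κ) (hs : s ∈ sizeVectors κ n) (z : Fin n → ℂ) (i : Fin κ)
    {k : ℕ} (hk : k < s (i + 1)) (hne : edge z (contactPos n s i + Fin.ofNat n k) ≠ 0) :
    incr (sideLength κ (contactHeight s z) (i + 1)) ((affineChi n s z).2 (i + 1)) (k + 1) /
      incr (sideLength κ (contactHeight s z) i) ((affineChi n s z).2 i) (s i + (k + 1)) =
      Real.sin (angle (edge z (contactPos n s i + Fin.ofNat n k)) - sideAngle κ i) /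
      Real.sin (sideAngle κ (i + 1 : ℕ) - angle (edge z (contactPos n s i + Fin.ofNat n k))) := by
  have h1 := norm_ne_zero_iff.2 hne
  rw [incr_affineChi_second hκ hs z i hk, incr_affineChi_first hκ hs z i hk,
    div_div_div_cancel_right₀ (sin_theta_pos hκ).ne', mul_div_mul_left _ _ h1]

theorem val_contactPos_add (hs : ∑ j, s j = n) (i : Fin κ) {k : ℕ} (hk : k < s (i + 1)) :
    ((contactPos n s i + Fin.ofNat n k : Fin n) : ℕ) = partialSum s i + k := by
  rw [contactPos, ← ofNat_add, val_ofNat_of_lt]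
  have h1 := partialSum_val_add_one s i
  have h2 := partialSum_le s hs (show (i + 1 : ℕ) ≤ κ from i.2)
  omega

theorem eq_contactPos_add (i : Fin κ) {m : Fin n} (h1 : partialSum s i ≤ m)
    (h2 : (m : ℕ) < partialSum s (i + 1 : ℕ)) :
    (m : ℕ) - partialSum s i < s (i + 1) ∧
      m = contactPos n s i + Fin.ofNat n ((m : ℕ) - partialSum s i) := by
  rw [partialSum_val_add_one] at h2
  refine ⟨by omega, ?_⟩
  rw [contactPos, ← ofNat_add, Nat.add_sub_cancel' h1, ofNat_val]

/-- A tuple whose parameters belong to `paramSet` has its boundary vectors sorted in the prescribed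
corners. -/
theorem isCornerSorted_of_affineChi_mem (hκ : 3 ≤ κ) (hs : s ∈ sizeVectors κ n)
    (hz : affineChi n s z ∈ paramSet κ s) : IsCornerSorted s z := by
  have hS := sin_theta_pos hκ
  obtain ⟨hell, hsimp, hratio⟩ := hz
  rw [strictMonoOn_ratio_iff] at hratio
  have hpos : ∀ j, ∀ t < numPart s j + 1, 0 < incr (sideLength κ (contactHeight s z) j)
      ((affineChi n s z).2 j) (t + 1) := fun j t ht => incr_pos (hsimp j) (hell.2 j) ht
  have hcorner : ∀ (i : Fin κ) (k : ℕ), k < s (i + 1) →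
      edge z (contactPos n s i + Fin.ofNat n k) ≠ 0 ∧
      sideAngle κ i < angle (edge z (contactPos n s i + Fin.ofNat n k)) ∧
      angle (edge z (contactPos n s i + Fin.ofNat n k)) < sideAngle κ (i + 1 : ℕ) := by
    intro i k hk
    have h1 := hpos (i + 1) k (by unfold numPart; omega)
    have h2 := hpos i (s i + k) (by unfold numPart; omega)
    rw [incr_affineChi_second hκ hs z i hk] at h1
    rw [add_assoc, incr_affineChi_first hκ hs z i hk] at h2
    have h1' := pos_of_mul_pos_right ((div_pos_iff_of_pos_right hS).1 h1) (norm_nonneg _)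
    have h2' := pos_of_mul_pos_right ((div_pos_iff_of_pos_right hS).1 h2) (norm_nonneg _)
    obtain ⟨q1, q2, q3⟩ := sideAngle_val_lt hκ i
    have ha := angle_mem (edge z (contactPos n s i + Fin.ofNat n k))
    refine ⟨fun h0 => ?_, lt_and_lt_of_sin_pos ha.1 ha.2.le (sideAngle_nonneg κ _) q3 q1 q2 h1' h2'⟩
    rw [h0, norm_zero, zero_mul, zero_div] at h1
    exact lt_irrefl _ h1
  have hmem : ∀ (i : Fin κ) (m : Fin n), partialSum s i ≤ m → (m : ℕ) < partialSum s (i + 1 : ℕ) →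
      sideAngle κ i < angle (edge z m) ∧ angle (edge z m) < sideAngle κ (i + 1 : ℕ) := by
    intro i m h1 h2
    obtain ⟨hk, hm⟩ := eq_contactPos_add i h1 h2
    rw [hm]
    exact (hcorner i _ hk).2
  refine ⟨fun m m' hlt => ?_, hmem⟩
  obtain ⟨i, h1, h2⟩ := exists_corner s hs.1 m.2
  obtain ⟨i', h1', h2'⟩ := exists_corner s hs.1 m'.2
  have hlt' := Fin.lt_def.1 hlt
  rcases lt_trichotomy (i : ℕ) i' with h | h | h
  · have ha := (hmem i m h1 h2).2
    have hb := (hmem i' m' h1' h2').1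
    have := sideAngle_mono κ (show (i + 1 : ℕ) ≤ i' from h)
    show angle (edge z m) < angle (edge z m')
    linarith
  · obtain rfl : i = i' := Fin.ext h
    obtain ⟨hk, hm⟩ := eq_contactPos_add i h1 h2
    obtain ⟨hk', hm'⟩ := eq_contactPos_add i h1' h2'
    have hr := hratio i (a := (m : ℕ) - partialSum s i + 1)
      (b := (m' : ℕ) - partialSum s i + 1) ⟨by omega, by omega⟩ ⟨by omega, by omega⟩ (by omega)
    have e1 := incr_div_incr hκ hs z i hk (hcorner i _ hk).1
    have e2 := incr_div_incr hκ hs z i hk' (hcorner i _ hk').1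
    change incr (sideLength κ (contactHeight s z) (i + 1)) _ _ /
      incr (sideLength κ (contactHeight s z) i) _ _ <
      incr (sideLength κ (contactHeight s z) (i + 1)) _ _ /
      incr (sideLength κ (contactHeight s z) i) _ _ at hr
    rw [e1, e2, ← hm, ← hm', sin_div_sin_lt_iff (sideAngle_val_lt hκ i).2.1 (hmem i m h1 h2).1
      (hmem i m h1 h2).2 (hmem i m' h1' h2').1 (hmem i m' h1' h2').2] at hr
    exact hr
  · have := partialSum_mono s (show (i' + 1 : ℕ) ≤ i from h)
    omega

theorem IsCornerSorted.affineChi_mem (h : IsCornerSorted s z) (hκ : 3 ≤ κ)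
    (hs : s ∈ sizeVectors κ n) (hpos : ∀ j, 0 < contactHeight s z j) :
    affineChi n s z ∈ openParamSet κ s := by
  have hS := sin_theta_pos hκ
  have hcorner : ∀ (i : Fin κ) (k : ℕ), k < s (i + 1) →
      edge z (contactPos n s i + Fin.ofNat n k) ≠ 0 ∧
      sideAngle κ i < angle (edge z (contactPos n s i + Fin.ofNat n k)) ∧
      angle (edge z (contactPos n s i + Fin.ofNat n k)) < sideAngle κ (i + 1 : ℕ) := by
    intro i k hk
    have hv := val_contactPos_add hs.1 i hk
    refine ⟨h.edge_ne_zero hs.1 _, h.mem_corner i _ (by omega) ?_⟩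
    rw [hv, partialSum_val_add_one]; omega
  have hincr : ∀ j, ∀ t < numPart s j + 1, 0 < incr (sideLength κ (contactHeight s z) j)
      ((affineChi n s z).2 j) (t + 1) := by
    intro j t ht
    have hN : numPart s j + 1 = s j + s (j + 1) := by
      have := hs.2 (j + 1)
      rw [add_sub_cancel_right] at this
      unfold numPart; omega
    rw [hN] at ht
    by_cases htj : t < s j
    · obtain ⟨i, rfl⟩ : ∃ i, j = i + 1 := ⟨j - 1, by simp⟩
      obtain ⟨q0, q1, q2⟩ := hcorner i t htj
      rw [incr_affineChi_second hκ hs z i htj]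
      have := (sideAngle_val_lt hκ i).2.1
      exact div_pos (mul_pos (norm_pos_iff.2 q0)
        (Real.sin_pos_of_pos_of_lt_pi (by linarith) (by linarith))) hS
    · obtain ⟨k, rfl⟩ : ∃ k, t = s j + k := ⟨t - s j, by omega⟩
      have hk : k < s (j + 1) := by omega
      obtain ⟨q0, q1, q2⟩ := hcorner j k hk
      rw [add_assoc, incr_affineChi_first hκ hs z j hk]
      have := (sideAngle_val_lt hκ j).2.1
      exact div_pos (mul_pos (norm_pos_iff.2 q0)
        (Real.sin_pos_of_pos_of_lt_pi (by linarith) (by linarith))) hS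
  have hsimp := fun j => mem_simplexP_of_incr_pos (hincr j)
  refine ⟨⟨⟨fun j => (hpos j).le, fun j => (hsimp j).2⟩, fun j => (hsimp j).1,
    (strictMonoOn_ratio_iff _).2 fun i => ?_⟩, hpos⟩
  rintro a ⟨ha1, ha2⟩ b ⟨hb1, hb2⟩ hab
  obtain ⟨a, rfl⟩ := Nat.exists_eq_add_of_le' ha1
  obtain ⟨b, rfl⟩ := Nat.exists_eq_add_of_le' hb1
  obtain ⟨q0, q1, q2⟩ := hcorner i a ha2
  obtain ⟨r0, r1, r2⟩ := hcorner i b hb2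
  change incr (sideLength κ (contactHeight s z) (i + 1)) _ _ /
      incr (sideLength κ (contactHeight s z) i) _ _ <
      incr (sideLength κ (contactHeight s z) (i + 1)) _ _ /
      incr (sideLength κ (contactHeight s z) i) _ _
  rw [incr_div_incr hκ hs z i ha2 q0, incr_div_incr hκ hs z i hb2 r0,
    sin_div_sin_lt_iff (sideAngle_val_lt hκ i).2.1 q1 q2 r1 r2]
  apply h.strictMono
  rw [Fin.lt_def, val_contactPos_add hs.1 i ha2, val_contactPos_add hs.1 i hb2]
  omega

/-- The preimage of `openParamSet` consists of convex tuples, on which `chi` is affine. -/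
theorem mem_convexTuplesOfSize_of_affineChi_mem (hκ : 3 ≤ κ) (hs : s ∈ sizeVectors κ n)
    (hz : affineChi n s z ∈ openParamSet κ s) :
    z ∈ convexTuplesOfSize κ n s ∧ chi κ n s z = affineChi n s z := by
  have h := isCornerSorted_of_affineChi_mem hκ hs hz.1
  exact ⟨h.mem_convexTuplesOfSize hκ hs hz.2, h.chi_eq hs.1⟩

/-- A convex tuple with parameters outside `openParamSet` has a boundary vector parallel to a side
or a point on a side line of the regular polygon. -/
theorem exists_eq_zero_of_affineChi_notMem (hκ : 3 ≤ κ) (hs : s ∈ sizeVectors κ n)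
    (hz : z ∈ convexTuplesOfSize κ n s) (hz' : affineChi n s z ∉ openParamSet κ s) :
    (∃ j m, cross (dir κ j) (edge z m) = 0) ∨ ∃ j, contactHeight s z j = 0 := by
  by_contra! hc
  refine hz' ((isCornerSorted_of_mem hκ hs hz hc.1).affineChi_mem hκ hs fun j => ?_)
  exact lt_of_le_of_ne (hz.1.2 _ j) (hc.2 j).symm

end

/-! ### The linear part of the extraction map -/

/-- The linear form `v ↦ cross a v`. -/
noncomputable def crossForm (a : ℂ) : ℂ →ₗ[ℝ] ℝ where
  toFun := cross a
  map_add' := cross_add a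
  map_smul' t v := by simp [cross_ofReal_mul]

/-- The linear form `v ↦ obliqueCoord a e v`. -/
noncomputable def obliqueForm (a e : ℂ) : ℂ →ₗ[ℝ] ℝ := (cross a e)⁻¹ • crossForm a

theorem crossForm_apply (a v : ℂ) : crossForm a v = cross a v := rfl

theorem obliqueForm_apply (a e v : ℂ) : obliqueForm a e v = obliqueCoord a e v := by
  rw [obliqueCoord_eq, obliqueForm, LinearMap.smul_apply, crossForm_apply, smul_eq_mul,
    inv_mul_eq_div]

/-- The numbering of the coordinates of `ParamSpace s`: distances and entries of the
side-partitions. -/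
abbrev Coord (s : Fin κ → ℕ) : Type := Fin κ ⊕ (Σ j : Fin κ, Fin (numPart s j))

/-- The index of the point on which a coordinate of `affineChi` depends, once the vertices of the
circumscribed polygon are fixed. -/
def coordPos (n : ℕ) [NeZero n] (s : Fin κ → ℕ) : Coord s → Fin n
  | Sum.inl j => contactPos n s j
  | Sum.inr ⟨j, i⟩ => contactPos n s (j - 1) + Fin.ofNat n (i + 1)

/-- The linear form giving a coordinate of `affineChi` as a function of the point it depends on. -/
noncomputable def coordForm (s : Fin κ → ℕ) : Coord s → ℂ →ₗ[ℝ] ℝ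
  | Sum.inl j => crossForm (dir κ j)
  | Sum.inr ⟨j, i⟩ =>
    if (i : ℕ) + 1 ≤ s j then obliqueForm (dir κ (j - 1)) (dir κ j)
    else obliqueForm (dir κ (j + 1)) (dir κ j)

/-- The linear part of `affineChi` for fixed vertices of the circumscribed polygon. -/
noncomputable def pointwiseChi (n : ℕ) [NeZero n] (s : Fin κ → ℕ) :
    (Fin n → ℂ) →ₗ[ℝ] ParamSpace s :=
  LinearMap.prod
    (LinearMap.pi fun j => coordForm s (Sum.inl j) ∘ₗ LinearMap.proj (coordPos n s (Sum.inl j)))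
    (LinearMap.pi fun j => LinearMap.pi fun i =>
      coordForm s (Sum.inr ⟨j, i⟩) ∘ₗ LinearMap.proj (coordPos n s (Sum.inr ⟨j, i⟩)))

/-- The linear part of `ecpVertex`. -/
noncomputable def vertexMap (j : Fin κ) : (Fin κ → ℝ) →ₗ[ℝ] ℂ where
  toFun ℓ := ((ℓ (j - 1) : ℂ) * dir κ j - (ℓ j : ℂ) * dir κ (j - 1)) / (Real.sin (theta κ) : ℂ)
  map_add' ℓ ℓ' := by simp only [Pi.add_apply, Complex.ofReal_add]; ring
  map_smul' t ℓ := by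
    simp only [Pi.smul_apply, smul_eq_mul, Complex.ofReal_mul, RingHom.id_apply, Complex.real_smul]
    ring

/-- The effect of the displacement of the vertices of the circumscribed polygon on the
side-partitions. -/
noncomputable def vertexShift (s : Fin κ → ℕ) :
    (Fin κ → ℝ) →ₗ[ℝ] ((j : Fin κ) → Fin (numPart s j) → ℝ) :=
  LinearMap.pi fun j => LinearMap.pi fun i => coordForm s (Sum.inr ⟨j, i⟩) ∘ₗ vertexMap j

/-- The shear `(ℓ, u) ↦ (ℓ, u - vertexShift ℓ)`. -/
noncomputable def shear (s : Fin κ → ℕ) : ParamSpace s →ₗ[ℝ] ParamSpace s :=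
  LinearMap.prod (LinearMap.fst ℝ _ _)
    (LinearMap.snd ℝ _ _ - vertexShift s ∘ₗ LinearMap.fst ℝ _ _)

/-- The linear part of `affineChi`. -/
noncomputable def linearChi (n : ℕ) [NeZero n] (s : Fin κ → ℕ) :
    (Fin n → ℂ) →ₗ[ℝ] ParamSpace s := shear s ∘ₗ pointwiseChi n s

theorem contactHeight_eq (s : Fin κ → ℕ) (z : Fin n → ℂ) :
    contactHeight s z = (pointwiseChi n s z).1 + contactHeight s (0 : Fin n → ℂ) := by
  funext j
  rw [Pi.add_apply, ← sub_eq_iff_eq_add, contactHeight, contactHeight, height_sub_height,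
    Pi.zero_apply, sub_zero]
  rfl

theorem ecpVertex_add (ℓ ℓ' : Fin κ → ℝ) (j : Fin κ) :
    ecpVertex κ (ℓ + ℓ') j = vertexMap j ℓ + ecpVertex κ ℓ' j := by
  rw [← sub_eq_iff_eq_add, ← sub_eq_zero]
  simp only [ecpVertex, vertexMap, LinearMap.coe_mk, AddHom.coe_mk, Pi.add_apply,
    Complex.ofReal_add]
  ring

theorem affineChi_eq (s : Fin κ → ℕ) (z : Fin n → ℂ) :
    affineChi n s z = linearChi n s z + affineChi n s 0 := by
  refine Prod.ext (contactHeight_eq s z) ?_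
  funext j i
  have h1 : ∀ z : Fin n → ℂ, (affineChi n s z).2 j i = coordForm s (Sum.inr ⟨j, i⟩)
      (z (coordPos n s (Sum.inr ⟨j, i⟩)) - ecpVertex κ (contactHeight s z) j) := by
    intro z
    simp only [affineChi, coordForm, coordPos]
    split_ifs <;> rw [obliqueForm_apply]
  have h2 : (linearChi n s z).2 j i = coordForm s (Sum.inr ⟨j, i⟩)
      (z (coordPos n s (Sum.inr ⟨j, i⟩)) - vertexMap j (pointwiseChi n s z).1) := by
    rw [map_sub]; rfl
  rw [Prod.snd_add, Pi.add_apply, Pi.add_apply, h1, h1, h2, contactHeight_eq, ecpVertex_add,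
    ← map_add]
  congr 1
  simp only [Pi.zero_apply]
  ring

/-! ### The determinant -/

/-- The canonical basis of `(ℝ²)^n`. -/
noncomputable abbrev pointBasis (n : ℕ) : Module.Basis (Σ _ : Fin n, Fin 2) ℝ (Fin n → ℂ) :=
  Pi.basis fun _ : Fin n => Complex.basisOneI

/-- The canonical basis of `ParamSpace s`. -/
noncomputable abbrev paramBasis (s : Fin κ → ℕ) : Module.Basis (Coord s) ℝ (ParamSpace s) :=
  (Pi.basisFun ℝ (Fin κ)).prod (Pi.basis fun j => Pi.basisFun ℝ (Fin (numPart s j)))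

theorem paramBasis_repr_inl (s : Fin κ → ℕ) (x : ParamSpace s) (j : Fin κ) :
    (paramBasis s).repr x (Sum.inl j) = x.1 j := by
  simp [paramBasis]

theorem paramBasis_repr_inr (s : Fin κ → ℕ) (x : ParamSpace s) (j : Fin κ)
    (i : Fin (numPart s j)) : (paramBasis s).repr x (Sum.inr ⟨j, i⟩) = x.2 j i := by
  simp [paramBasis]

theorem det_toMatrix_shear (s : Fin κ → ℕ) :
    (LinearMap.toMatrix (paramBasis s) (paramBasis s) (shear s)).det = 1 := by
  set A := LinearMap.toMatrix (paramBasis s) (paramBasis s) (shear s) with hA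
  have h11 : A.toBlocks₁₁ = 1 := by
    ext j j'
    rw [Matrix.toBlocks₁₁, Matrix.of_apply, hA, LinearMap.toMatrix_apply, paramBasis_repr_inl]
    simp [shear, paramBasis, Matrix.one_apply, Pi.single_apply]
  have h12 : A.toBlocks₁₂ = 0 := by
    ext j q
    rw [Matrix.toBlocks₁₂, Matrix.of_apply, hA, LinearMap.toMatrix_apply, paramBasis_repr_inl]
    simp [shear, paramBasis]
  have h22 : A.toBlocks₂₂ = 1 := by
    ext ⟨j, i⟩ q
    rw [Matrix.toBlocks₂₂, Matrix.of_apply, hA, LinearMap.toMatrix_apply, paramBasis_repr_inr]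
    have : (shear s (paramBasis s (Sum.inr q))).2 = (paramBasis s (Sum.inr q)).2 := by
      simp [shear, paramBasis]
    rw [this, ← paramBasis_repr_inr, Module.Basis.repr_self, Matrix.one_apply, Finsupp.single_apply]
    simp [eq_comm]
  rw [← Matrix.fromBlocks_toBlocks A, h11, h12, h22, Matrix.det_fromBlocks_zero₁₂]
  simp

/-- The displacement of the vertices does not change the determinant. -/
theorem detWith_linearChi {s : Fin κ → ℕ} (e : (Σ _ : Fin n, Fin 2) ≃ Coord s) :
    detWith e (linearChi n s) = detWith e (pointwiseChi n s) := by
  have : LinearMap.toMatrix (pointBasis n) (paramBasis s) (linearChi n s) =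
      LinearMap.toMatrix (paramBasis s) (paramBasis s) (shear s) *
        LinearMap.toMatrix (pointBasis n) (paramBasis s) (pointwiseChi n s) :=
    LinearMap.toMatrix_comp _ _ _ _ _
  rw [detWith, this, ← Matrix.submatrix_mul_equiv _ _ e e id, Matrix.det_mul,
    Matrix.det_submatrix_equiv_self, det_toMatrix_shear, one_mul]
  rfl

/-- The determinant of a pair of linear forms on the plane. -/
noncomputable def formDet (f g : ℂ →ₗ[ℝ] ℝ) : ℝ := f 1 * g Complex.I - f Complex.I * g 1

theorem formDet_crossForm (x y : ℝ) (a b : ℂ) :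
    formDet (x • crossForm a) (y • crossForm b) = x * y * cross a b := by
  simp [formDet, crossForm_apply, cross_eq]; ring

theorem toMatrix_pointwiseChi (s : Fin κ → ℕ) (q : Coord s) (m : Fin n) (a : Fin 2) :
    LinearMap.toMatrix (pointBasis n) (paramBasis s) (pointwiseChi n s) q ⟨m, a⟩ =
      if coordPos n s q = m then coordForm s q (Complex.basisOneI a) else 0 := by
  have h : (paramBasis s).repr (pointwiseChi n s (pointBasis n ⟨m, a⟩)) q =
      coordForm s q (pointBasis n ⟨m, a⟩ (coordPos n s q)) := by
    rcases q with j | ⟨j, i⟩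
    · rw [paramBasis_repr_inl]; rfl
    · rw [paramBasis_repr_inr]; rfl
  rw [LinearMap.toMatrix_apply, h]
  simp only [pointBasis, Pi.basis_apply, Pi.single_apply]
  split_ifs with h1
  · rfl
  · simp

/-- If `e` gives to each point two coordinates that depend only on it, then the matrix is block
diagonal. -/
theorem detWith_pointwiseChi {s : Fin κ → ℕ} (e : (Σ _ : Fin n, Fin 2) ≃ Coord s)
    (he : ∀ m a, coordPos n s (e ⟨m, a⟩) = m) :
    detWith e (pointwiseChi n s) =
      ∏ m, formDet (coordForm s (e ⟨m, 0⟩)) (coordForm s (e ⟨m, 1⟩)) := by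
  have h : (LinearMap.toMatrix (pointBasis n) (paramBasis s) (pointwiseChi n s)).submatrix e id =
      (Matrix.blockDiagonal fun m => Matrix.of fun a b : Fin 2 =>
        coordForm s (e ⟨m, a⟩) (Complex.basisOneI b)).submatrix
        ((Equiv.sigmaEquivProd (Fin n) (Fin 2)).trans (Equiv.prodComm _ _))
        ((Equiv.sigmaEquivProd (Fin n) (Fin 2)).trans (Equiv.prodComm _ _)) := by
    ext ⟨m, a⟩ ⟨m', a'⟩
    simp [Matrix.submatrix_apply, toMatrix_pointwiseChi, he, Matrix.blockDiagonal_apply]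
  rw [detWith]
  change ((LinearMap.toMatrix (pointBasis n) (paramBasis s) (pointwiseChi n s)).submatrix e id).det
    = _
  rw [h, Matrix.det_submatrix_equiv_self, Matrix.det_blockDiagonal]
  refine Finset.prod_congr rfl fun m _ => ?_
  rw [Matrix.det_fin_two]
  simp [formDet]

/-- The index of the `k`-th point of the corner `j`, the contact point `cp_j` being the last one. -/
def cornerPoint (n : ℕ) [NeZero n] (s : Fin κ → ℕ) (p : Σ j : Fin κ, Fin (s j)) : Fin n :=
  contactPos n s (p.1 - 1) + Fin.ofNat n (p.2 + 1)

theorem bijective_cornerPoint {s : Fin κ → ℕ} (hs : ∑ j, s j = n) :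
    Function.Bijective (cornerPoint n s) := by
  rw [Fintype.bijective_iff_surjective_and_card]
  refine ⟨fun m => ?_, by simp [hs]⟩
  obtain ⟨i, h1, h2⟩ := exists_corner s hs (m - 1).2
  obtain ⟨hk, hm⟩ := eq_contactPos_add i h1 h2
  refine ⟨⟨i + 1, ⟨_, hk⟩⟩, ?_⟩
  rw [cornerPoint]
  simp only [add_sub_cancel_right]
  rw [ofNat_add, ← add_assoc, ← hm, ofNat_one, sub_add_cancel]

/-- The two coordinates that depend on the `k`-th point of the corner `j`: its coordinates on the
sides `j - 1` and `j` if it is not a contact point; its coordinate on the side `j` and the distance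
to this side if it is the contact point of the side `j` only; the distances to the sides `j` and
`j + 1` if it is the contact point of both. The order makes all the determinants positive. -/
def cornerCoord {s : Fin κ → ℕ} (p : (Σ j : Fin κ, Fin (s j)) × Fin 2) : Coord s :=
  if h : (p.1.2 : ℕ) + 1 < s p.1.1 then
    if p.2 = 0 then
      Sum.inr ⟨p.1.1 - 1, ⟨s (p.1.1 - 1) + p.1.2, by rw [numPart, sub_add_cancel]; omega⟩⟩
    else Sum.inr ⟨p.1.1, ⟨p.1.2, by rw [numPart]; omega⟩⟩
  else if h' : s (p.1.1 + 1) ≠ 0 then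
    if p.2 = 0 then Sum.inr ⟨p.1.1, ⟨p.1.2, by have := p.1.2.2; rw [numPart]; omega⟩⟩
    else Sum.inl p.1.1
  else if p.2 = 0 then Sum.inl p.1.1 else Sum.inl (p.1.1 + 1)

theorem card_coord {s : Fin κ → ℕ} (hs : s ∈ sizeVectors κ n) :
    Fintype.card (Coord s) = n * 2 := by
  have h1 : ∑ j, (numPart s j + 1) = ∑ j, (s j + s (j + 1)) := by
    refine Finset.sum_congr rfl fun j _ => ?_
    have := hs.2 (j + 1)
    rw [add_sub_cancel_right] at this
    rw [numPart]; omega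
  have h2 : ∑ j, s (j + 1) = n := by
    rw [← hs.1]; exact Equiv.sum_comp (Equiv.addRight (1 : Fin κ)) s
  rw [Finset.sum_add_distrib, Finset.sum_add_distrib, h2, hs.1] at h1
  simp at h1
  simp
  omega

theorem bijective_cornerCoord {s : Fin κ → ℕ} (hs : s ∈ sizeVectors κ n) :
    Function.Bijective (cornerCoord (s := s)) := by
  rw [Fintype.bijective_iff_surjective_and_card]
  refine ⟨?_, by rw [card_coord hs]; simp [hs.1]⟩
  have hinl : ∀ j, s j ≠ 0 → ∃ p, cornerCoord (s := s) p = Sum.inl j := by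
    intro j hj
    by_cases h' : s (j + 1) ≠ 0
    · exact ⟨(⟨j, ⟨s j - 1, by omega⟩⟩, 1), by
        rw [cornerCoord, dif_neg (by simp only; omega), dif_pos h']; rfl⟩
    · exact ⟨(⟨j, ⟨s j - 1, by omega⟩⟩, 0), by
        rw [cornerCoord, dif_neg (by simp only; omega), dif_neg h']; rfl⟩
  have hright : ∀ j k (hk : k < numPart s (j - 1)), s (j - 1) ≤ k →
      ∃ p, cornerCoord (s := s) p = Sum.inr ⟨j - 1, ⟨k, hk⟩⟩ := by
    intro j k hk hle
    have hk' : k - s (j - 1) + 1 < s j := by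
      rw [numPart, sub_add_cancel] at hk; omega
    refine ⟨(⟨j, ⟨k - s (j - 1), by omega⟩⟩, 0), ?_⟩
    rw [cornerCoord, dif_pos hk']
    simp only [if_true]
    congr 3
    omega
  rintro (j | ⟨j, k, hk⟩)
  · by_cases hj : s j = 0
    · obtain ⟨i, rfl⟩ : ∃ i, j = i + 1 := ⟨j - 1, by simp⟩
      have hi := hs.2 (i + 1)
      rw [add_sub_cancel_right] at hi
      exact ⟨(⟨i, ⟨s i - 1, by omega⟩⟩, 1), by
        rw [cornerCoord, dif_neg (by simp only; omega), dif_neg (by simpa using hj)]; rfl⟩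
    · exact hinl j hj
  · by_cases hkj : k < s j
    · by_cases hlt : k + 1 < s j
      · exact ⟨(⟨j, ⟨k, hkj⟩⟩, 1), by rw [cornerCoord, dif_pos hlt]; rfl⟩
      · have h' : s (j + 1) ≠ 0 := by rw [numPart] at hk; omega
        exact ⟨(⟨j, ⟨k, hkj⟩⟩, 0), by rw [cornerCoord, dif_neg hlt, dif_pos h']; rfl⟩
    · obtain ⟨i, rfl⟩ : ∃ i, j = i - 1 := ⟨j + 1, by simp⟩
      exact hright i k hk (by omega)

theorem coordPos_cornerCoord {s : Fin κ → ℕ} (hs : ∑ j, s j = n)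
    (p : (Σ j : Fin κ, Fin (s j)) × Fin 2) :
    coordPos n s (cornerCoord p) = cornerPoint n s p.1 := by
  obtain ⟨⟨j, k, hk⟩, a⟩ := p
  have hlast : ¬ k + 1 < s j → contactPos n s j = contactPos n s (j - 1) + Fin.ofNat n (k + 1) := by
    intro h
    rw [contactPos_eq s hs, show k + 1 = s j by omega]
  unfold cornerCoord
  simp only
  split_ifs with h1 h2 h3 h4 h5
  · simp only [coordPos, cornerPoint]
    rw [contactPos_eq s hs (j - 1), add_assoc, add_assoc, ofNat_add]
  · rfl
  · rfl
  · exact hlast h1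
  · exact hlast h1
  · simp only [coordPos, cornerPoint]
    rw [contactPos_add_one s hs, not_not.1 h3, ofNat_zero, add_zero]
    exact hlast h1

theorem formDet_cornerCoord {s : Fin κ → ℕ} (hκ : 3 ≤ κ) (p : Σ j : Fin κ, Fin (s j)) :
    formDet (coordForm s (cornerCoord (p, 0))) (coordForm s (cornerCoord (p, 1))) =
      if (p.2 : ℕ) + 1 < s p.1 then (Real.sin (theta κ))⁻¹
      else if s (p.1 + 1) = 0 then Real.sin (theta κ) else 1 := by
  obtain ⟨j, k, hk⟩ := p
  have hS := (sin_theta_pos hκ).ne'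
  have hj1 : cross (dir κ (j - 1)) (dir κ j) = Real.sin (theta κ) := cross_dir_sub_one_dir j
  have hj2 : cross (dir κ j) (dir κ (j - 1)) = -Real.sin (theta κ) := by rw [cross_comm, hj1]
  have hj3 : cross (dir κ j) (dir κ (j + 1)) = Real.sin (theta κ) := cross_dir_dir_add_one j
  have hone : ∀ a, crossForm a = (1 : ℝ) • crossForm a := fun a => (one_smul _ _).symm
  by_cases h1 : k + 1 < s j
  · rw [if_pos h1, cornerCoord, cornerCoord, dif_pos h1, dif_pos h1, if_pos rfl,
      if_neg (by simp)]
    simp only [coordForm]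
    rw [if_neg (by omega), if_pos (by omega), obliqueForm, obliqueForm, formDet_crossForm,
      sub_add_cancel, hj1, hj2]
    field_simp
  · by_cases h2 : s (j + 1) = 0
    · rw [if_neg h1, if_pos h2, cornerCoord, cornerCoord, dif_neg h1, dif_neg h1,
        dif_neg (not_not.2 h2), dif_neg (not_not.2 h2), if_pos rfl, if_neg (by simp)]
      simp only [coordForm]
      rw [hone (dir κ j), hone (dir κ (j + 1)), formDet_crossForm, hj3]
      ring
    · rw [if_neg h1, if_neg h2, cornerCoord, cornerCoord, dif_neg h1, dif_neg h1,
        dif_pos h2, dif_pos h2, if_pos rfl, if_neg (by simp)]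
      simp only [coordForm]
      rw [if_pos (by omega), obliqueForm, hone (dir κ j), formDet_crossForm, hj1]
      field_simp

/-- There are `n - κ` more points that are not contact points than double contact points. -/
theorem prod_formDet {s : Fin κ → ℕ} (hs : s ∈ sizeVectors κ n) {S : ℝ} (hS : S ≠ 0) :
    ∏ p : Σ j : Fin κ, Fin (s j),
      (if (p.2 : ℕ) + 1 < s p.1 then S⁻¹ else if s (p.1 + 1) = 0 then S else 1) =
      1 / S ^ ((n : ℤ) - (κ : ℤ)) := by
  have inner : ∀ j, ∏ k : Fin (s j),
      (if (k : ℕ) + 1 < s j then S⁻¹ else if s (j + 1) = 0 then S else 1) =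
      (if s j = 0 then 1 else S⁻¹ ^ (s j - 1)) * (if s (j + 1) = 0 then S else 1) := by
    intro j
    have hj := hs.2 (j + 1)
    rw [add_sub_cancel_right] at hj
    generalize s (j + 1) = b at hj ⊢
    generalize s j = a at hj ⊢
    rcases a with _ | t
    · have : b ≠ 0 := by omega
      simp [this]
    · rw [Fin.prod_univ_castSucc]
      simp
  -- if `s (j + 1) = 0` then the last point of the corner `j` is a double contact point; its factor
  -- is attributed to the side `j + 1`
  have shift : ∏ j, (if s (j + 1) = 0 then S else 1) = ∏ j, (if s j = 0 then S else 1) :=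
    Equiv.prod_comp (Equiv.addRight (1 : Fin κ)) fun j => if s j = 0 then S else 1
  have each : ∀ j, (if s j = 0 then 1 else S⁻¹ ^ (s j - 1)) * (if s j = 0 then S else 1) =
      S * S⁻¹ ^ s j := by
    intro j
    generalize s j = a
    rcases a with _ | t
    · simp
    · simp [pow_succ]
      field_simp
  rw [Fintype.prod_sigma, Finset.prod_congr rfl fun j _ => inner j, Finset.prod_mul_distrib, shift,
    ← Finset.prod_mul_distrib, Finset.prod_congr rfl fun j _ => each j, Finset.prod_mul_distrib,
    Finset.prod_pow_eq_pow_sum, hs.1, Finset.prod_const, Finset.card_univ, Fintype.card_fin,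
    zpow_sub₀ hS, zpow_natCast, zpow_natCast, inv_pow,
    one_div_div, div_eq_mul_inv]

/-- For a suitable numbering of the coordinates, the linear part of the extraction map has
determinant `1 / sin θ ^ (n - κ)`. -/
theorem exists_detWith_linearChi {s : Fin κ → ℕ} (hκ : 3 ≤ κ) (hs : s ∈ sizeVectors κ n) :
    ∃ e : (Σ _ : Fin n, Fin 2) ≃ Coord s,
      detWith e (linearChi n s) = 1 / Real.sin (theta κ) ^ ((n : ℤ) - (κ : ℤ)) := by
  set π := Equiv.ofBijective _ (bijective_cornerPoint (n := n) hs.1) with hπ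
  set c := Equiv.ofBijective _ (bijective_cornerCoord hs) with hc
  refine ⟨(Equiv.sigmaEquivProd (Fin n) (Fin 2)).trans
    ((π.symm.prodCongr (Equiv.refl _)).trans c), ?_⟩
  rw [detWith_linearChi, detWith_pointwiseChi, ← prod_formDet hs (sin_theta_pos hκ).ne',
    ← π.symm.prod_comp]
  · refine Finset.prod_congr rfl fun m _ => ?_
    exact formDet_cornerCoord hκ (π.symm m)
  · intro m a
    exact (coordPos_cornerCoord hs.1 (π.symm m, a)).trans (π.apply_symm_apply m)

/-! ### Null sets -/

theorem volume_setOf_linearMap_eq {E : Type*} [NormedAddCommGroup E] [NormedSpace ℝ E]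
    [MeasurableSpace E] [BorelSpace E] [FiniteDimensional ℝ E] (μ : Measure E)
    [μ.IsAddHaarMeasure] {f : E →ₗ[ℝ] ℝ} (hf : f ≠ 0) (c : ℝ) : μ {x | f x = c} = 0 := by
  rcases Set.eq_empty_or_nonempty {x | f x = c} with h | ⟨x₀, hx₀⟩
  · rw [h, measure_empty]
  · have : {x | f x = c} = (fun x => x + -x₀) ⁻¹' (LinearMap.ker f : Set E) := by
      ext x
      have h0 : f x₀ = c := hx₀
      simp [h0, ← sub_eq_add_neg, sub_eq_zero]
    rw [this, measure_preimage_add_right]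
    exact Measure.addHaar_submodule μ _ fun h => hf (LinearMap.ker_eq_top.1 h)

theorem cross_dir_I_mul (j : Fin κ) : cross (dir κ j) (Complex.I * dir κ j) = 1 := by
  rw [cross, mul_left_comm, conj_dir_mul_dir]; simp

theorem volume_cross_edge_eq_zero (hn : 2 ≤ n) (j : Fin κ) (m : Fin n) :
    volume {z : Fin n → ℂ | cross (dir κ j) (edge z m) = 0} = 0 := by
  have h1 : m + 1 ≠ m := by
    intro h
    have h' : (1 : Fin n) = 0 := by simpa using h
    have := congrArg Fin.val h'
    rw [← ofNat_one, val_ofNat_of_lt hn] at this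
    simp at this
  refine volume_setOf_linearMap_eq (volume : Measure (Fin n → ℂ))
    (f := crossForm (dir κ j) ∘ₗ (LinearMap.proj (R := ℝ) (φ := fun _ : Fin n => ℂ) (m + 1) -
      LinearMap.proj (R := ℝ) (φ := fun _ : Fin n => ℂ) m)) (fun h => ?_) 0
  have := LinearMap.congr_fun h (Pi.single (m + 1) (Complex.I * dir κ j))
  simp [crossForm_apply, cross_dir_I_mul, h1.symm] at this

theorem volume_contactHeight_eq_zero (s : Fin κ → ℕ) (j : Fin κ) :
    volume {z : Fin n → ℂ | contactHeight s z j = 0} = 0 := by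
  have h := volume_setOf_linearMap_eq (volume : Measure (Fin n → ℂ))
    (f := crossForm (dir κ j) ∘ₗ LinearMap.proj (contactPos n s j)) (fun h => by
      have := LinearMap.congr_fun h (Pi.single (contactPos n s j) (Complex.I * dir κ j))
      simp [crossForm_apply, cross_dir_I_mul] at this) (-contactHeight s (0 : Fin n → ℂ) j)
  have hset : {z : Fin n → ℂ | contactHeight s z j = 0} =
      {z | (crossForm (dir κ j) ∘ₗ LinearMap.proj (contactPos n s j) : (Fin n → ℂ) →ₗ[ℝ] ℝ) z =
        -contactHeight s (0 : Fin n → ℂ) j} := by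
    ext z
    rw [mem_ofPred_eq, mem_ofPred_eq, eq_neg_iff_add_eq_zero, contactHeight_eq s z]
    rfl
  rw [hset, h]

instance isAddHaarMeasure_volume_paramSpace (s : Fin κ → ℕ) :
    (volume : Measure (ParamSpace s)).IsAddHaarMeasure :=
  Measure.prod.instIsAddHaarMeasure _ _

theorem volume_distance_eq_zero (s : Fin κ → ℕ) (j : Fin κ) :
    volume {x : ParamSpace s | x.1 j = 0} = 0 := by
  refine volume_setOf_linearMap_eq (volume : Measure (ParamSpace s))
    (f := (LinearMap.proj j ∘ₗ LinearMap.fst ℝ _ _ : ParamSpace s →ₗ[ℝ] ℝ)) (fun h => ?_) 0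
  have := LinearMap.congr_fun h (Pi.single j 1, 0)
  simp at this

theorem volume_convexTuplesOfSize_diff (hκ : 3 ≤ κ) {s : Fin κ → ℕ} (hs : s ∈ sizeVectors κ n) :
    volume (convexTuplesOfSize κ n s \ affineChi n s ⁻¹' openParamSet κ s) = 0 := by
  refine measure_mono_null (t := (⋃ j, ⋃ m, {z | cross (dir κ j) (edge z m) = 0}) ∪
    ⋃ j, {z | contactHeight s z j = 0}) ?_ ?_
  · rintro z ⟨hz, hz'⟩
    rcases exists_eq_zero_of_affineChi_notMem hκ hs hz hz' with ⟨j, m, h⟩ | ⟨j, h⟩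
    · exact Or.inl (mem_iUnion₂.2 ⟨j, m, h⟩)
    · exact Or.inr (mem_iUnion.2 ⟨j, h⟩)
  · exact measure_union_null (measure_iUnion_null fun j => measure_iUnion_null fun m =>
      volume_cross_edge_eq_zero (two_le_of_mem_sizeVectors hκ hs) j m)
      (measure_iUnion_null fun j => volume_contactHeight_eq_zero s j)

theorem volume_paramSet_diff (s : Fin κ → ℕ) :
    volume (paramSet κ s \ openParamSet κ s) = 0 := by
  refine measure_mono_null (t := ⋃ j, {x | x.1 j = 0}) ?_
    (measure_iUnion_null fun j => volume_distance_eq_zero s j)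
  rintro x ⟨hx, hx'⟩
  by_contra hc
  rw [mem_iUnion, not_exists] at hc
  exact hx' ⟨hx, fun j => lt_of_le_of_ne (hx.1.1 j) (Ne.symm (hc j))⟩

/-! ### Openness of the parameter set -/

theorem continuous_incr (s : Fin κ → ℕ) (j : Fin κ) (i : ℕ) :
    Continuous fun x : ParamSpace s => incr (sideLength κ x.1 j) (x.2 j) i := by
  have hc : Continuous fun x : ParamSpace s => sideLength κ x.1 j := by
    unfold sideLength; fun_prop
  have he : ∀ i, Continuous fun x : ParamSpace s => extend (sideLength κ x.1 j) (x.2 j) i := by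
    intro i
    unfold extend
    split_ifs
    · exact continuous_const
    · fun_prop
    · exact hc
  exact (he i).sub (he (i - 1))

theorem isOpen_openParamSet (s : Fin κ → ℕ) : IsOpen (openParamSet κ s) := by
  rw [isOpen_iff_eventually]
  rintro x ⟨⟨⟨-, hc⟩, hsimp, hratio⟩, hpos⟩
  rw [strictMonoOn_ratio_iff] at hratio
  have e1 : ∀ᶠ y : ParamSpace s in nhds x, ∀ j, 0 < y.1 j :=
    Filter.eventually_all.2 fun j =>
      (by fun_prop : Continuous fun y : ParamSpace s => y.1 j).continuousAt.eventually_const_lt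
        (hpos j)
  have e2 : ∀ᶠ y : ParamSpace s in nhds x, ∀ j, ∀ t ∈ Set.Iio (numPart s j + 1),
      0 < incr (sideLength κ y.1 j) (y.2 j) (t + 1) :=
    Filter.eventually_all.2 fun j => (Filter.eventually_all_finite (Set.finite_Iio _)).2 fun t ht =>
      (continuous_incr s j (t + 1)).continuousAt.eventually_const_lt (incr_pos (hsimp j) (hc j) ht)
  have e3 : ∀ᶠ y : ParamSpace s in nhds x, ∀ i, ∀ a ∈ Set.Icc 1 (s (i + 1)),
      ∀ b ∈ Set.Icc 1 (s (i + 1)), a < b →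
      incr (sideLength κ y.1 (i + 1)) (y.2 (i + 1)) a /
        incr (sideLength κ y.1 i) (y.2 i) (s i + a) <
      incr (sideLength κ y.1 (i + 1)) (y.2 (i + 1)) b /
        incr (sideLength κ y.1 i) (y.2 i) (s i + b) := by
    refine Filter.eventually_all.2 fun i =>
      (Filter.eventually_all_finite (Set.finite_Icc _ _)).2 fun a ha =>
      (Filter.eventually_all_finite (Set.finite_Icc _ _)).2 fun b hb => ?_
    rw [Filter.eventually_imp_distrib_left]
    intro hab
    have hcont : ∀ a ∈ Set.Icc 1 (s (i + 1)), ContinuousAt (fun y : ParamSpace s =>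
        incr (sideLength κ y.1 (i + 1)) (y.2 (i + 1)) a /
          incr (sideLength κ y.1 i) (y.2 i) (s i + a)) x := by
      rintro a ⟨ha1, ha2⟩
      refine (continuous_incr s _ _).continuousAt.div (continuous_incr s _ _).continuousAt ?_
      have := incr_pos (hsimp i) (hc i) (i := s i + (a - 1)) (by rw [numPart]; omega)
      rw [add_assoc, Nat.sub_add_cancel ha1] at this
      exact this.ne'
    exact (hcont a ha).eventually_lt (hcont b hb) (hratio i ha hb hab)
  filter_upwards [e1, e2, e3] with y h1 h2 h3
  have hs := fun j => mem_simplexP_of_incr_pos (h2 j)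
  exact ⟨⟨⟨fun j => (h1 j).le, fun j => (hs j).2⟩, fun j => (hs j).1,
    (strictMonoOn_ratio_iff y).2 fun i a ha b hb hab => h3 i a ha b hb hab⟩, h1⟩

/-! ### Linear maps and volumes -/

theorem volume_eq_pointBasis : (pointBasis n).addHaar = volume := by
  have h1 : volume (parallelepiped Complex.basisOneI) = 1 := by
    have := Complex.orthonormalBasisOneI.volume_parallelepiped
    rwa [← OrthonormalBasis.coe_toBasis, Complex.toBasis_orthonormalBasisOneI] at this
  have h2 : parallelepiped (pointBasis n) =
      Set.univ.pi fun _ : Fin n => parallelepiped Complex.basisOneI := by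
    ext z
    rw [parallelepiped_basis_eq, parallelepiped_basis_eq]
    simp only [mem_ofPred_eq, Set.mem_univ_pi, Sigma.forall, pointBasis, Pi.basis_repr]
  rw [Module.Basis.addHaar_eq_iff, Module.Basis.coe_parallelepiped, h2, volume_pi_pi]
  simp only [h1, Finset.prod_const_one]

theorem volume_eq_paramBasis (s : Fin κ → ℕ) : (paramBasis s).addHaar = volume := by
  have h2 : parallelepiped (paramBasis s) = (Set.univ.pi fun _ : Fin κ => Icc (0 : ℝ) 1) ×ˢ
      (Set.univ.pi fun j => Set.univ.pi fun _ : Fin (numPart s j) => Icc (0 : ℝ) 1) := by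
    ext z
    rw [parallelepiped_basis_eq]
    simp only [mem_ofPred_eq, Sum.forall, Sigma.forall, paramBasis_repr_inl, paramBasis_repr_inr,
      Set.mem_prod, Set.mem_univ_pi]
  rw [Module.Basis.addHaar_eq_iff, Module.Basis.coe_parallelepiped, h2, Measure.volume_eq_prod,
    Measure.prod_prod, volume_pi_pi, volume_pi_pi]
  simp only [volume_pi_pi, Real.volume_Icc, sub_zero, ENNReal.ofReal_one, Finset.prod_const_one,
    mul_one]

/-- The linear equivalence that identifies the two canonical bases according to `e`. -/
noncomputable def coordEquiv {s : Fin κ → ℕ} (e : (Σ _ : Fin n, Fin 2) ≃ Coord s) :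
    ParamSpace s ≃ₗ[ℝ] (Fin n → ℂ) := (paramBasis s).equiv (pointBasis n) e.symm

theorem map_coordEquiv {s : Fin κ → ℕ} (e : (Σ _ : Fin n, Fin 2) ≃ Coord s) :
    (paramBasis s).map (coordEquiv e) = (pointBasis n).reindex e := by
  ext1 q
  rw [Module.Basis.map_apply, coordEquiv, Module.Basis.equiv_apply, Module.Basis.reindex_apply]

theorem det_coordEquiv_comp {s : Fin κ → ℕ} (e : (Σ _ : Fin n, Fin 2) ≃ Coord s)
    (L : (Fin n → ℂ) →ₗ[ℝ] ParamSpace s) :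
    LinearMap.det ((coordEquiv e : ParamSpace s →ₗ[ℝ] (Fin n → ℂ)) ∘ₗ L) = detWith e L := by
  have h : ∀ x p, (pointBasis n).repr (coordEquiv e x) p = (paramBasis s).repr x (e p) := by
    intro x p
    have h1 := congrArg (fun b => b.repr (coordEquiv e x) (e p)) (map_coordEquiv e)
    simpa using h1.symm
  rw [← LinearMap.det_toMatrix (pointBasis n), detWith]
  congr 1
  ext p q
  rw [LinearMap.toMatrix_apply, Matrix.submatrix_apply, LinearMap.toMatrix_apply]
  exact h _ _

/-- For any numbering `e`, the factor by which `L` changes volumes is `detWith e L` up to sign. -/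
theorem volume_image_eq {s : Fin κ → ℕ} (e : (Σ _ : Fin n, Fin 2) ≃ Coord s)
    (L : (Fin n → ℂ) →ₗ[ℝ] ParamSpace s) (A : Set (Fin n → ℂ)) :
    volume (L '' A) = ENNReal.ofReal |detWith e L| * volume A := by
  have hmap : Measure.map (coordEquiv e).toContinuousLinearEquiv (volume : Measure (ParamSpace s))
      = volume := by
    rw [← volume_eq_paramBasis, Module.Basis.map_addHaar, ← volume_eq_pointBasis,
      ← Module.Basis.addHaar_reindex (pointBasis n) e, ← map_coordEquiv]
    rfl
  rw [← det_coordEquiv_comp, ← Measure.addHaar_image_linearMap, LinearMap.coe_comp, image_comp]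
  conv_rhs => rw [← hmap]
  exact ((coordEquiv e).toContinuousLinearEquiv.toHomeomorph.toMeasurableEquiv.map_apply _).symm ▸
    congrArg volume (preimage_image_eq _ (coordEquiv e).injective).symm

/-- The linear equivalence given by the linear part of the extraction map. -/
theorem exists_linearEquiv_of_detWith_ne_zero {s : Fin κ → ℕ}
    (e : (Σ _ : Fin n, Fin 2) ≃ Coord s) (L : (Fin n → ℂ) →ₗ[ℝ] ParamSpace s)
    (h : detWith e L ≠ 0) : ∃ M : (Fin n → ℂ) ≃ₗ[ℝ] ParamSpace s, ∀ z, M z = L z := by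
  rw [← det_coordEquiv_comp] at h
  refine ⟨(LinearEquiv.ofIsUnitDet (v := pointBasis n) (v' := pointBasis n)
    (f := (coordEquiv e : ParamSpace s →ₗ[ℝ] (Fin n → ℂ)) ∘ₗ L) ?_).trans (coordEquiv e).symm,
    fun z => ?_⟩
  · rw [LinearMap.det_toMatrix]; exact h.isUnit
  · simp

/-! ### The extraction map is a piecewise diffeomorphism -/

theorem continuous_affineChi (s : Fin κ → ℕ) : Continuous (affineChi n s) := by
  rw [funext (affineChi_eq (n := n) s)]
  exact (linearChi n s).continuous_of_finiteDimensional.add continuous_const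

theorem hasFDerivAt_affineChi (s : Fin κ → ℕ) (z : Fin n → ℂ) :
    HasFDerivAt (affineChi n s) (LinearMap.toContinuousLinearMap (linearChi n s)) z := by
  rw [funext (affineChi_eq (n := n) s)]
  exact (LinearMap.toContinuousLinearMap (linearChi n s)).hasFDerivAt.add_const _

theorem contDiff_affineChi (s : Fin κ → ℕ) : ContDiff ℝ ∞ (affineChi n s) := by
  rw [funext (affineChi_eq (n := n) s)]
  exact (LinearMap.toContinuousLinearMap (linearChi n s)).contDiff.add contDiff_const

/-- The set of tuples whose parameters lie in `openParamSet`. -/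
def openPiece (κ n : ℕ) [NeZero κ] [NeZero n] (s : Fin κ → ℕ) : Set (Fin n → ℂ) :=
  affineChi n s ⁻¹' openParamSet κ s

theorem isOpen_openPiece (s : Fin κ → ℕ) : IsOpen (openPiece κ n s) :=
  (isOpen_openParamSet s).preimage (continuous_affineChi s)

theorem chi_eqOn_openPiece (hκ : 3 ≤ κ) {s : Fin κ → ℕ} (hs : s ∈ sizeVectors κ n) :
    EqOn (chi κ n s) (affineChi n s) (openPiece κ n s) := fun _ hz =>
  (mem_convexTuplesOfSize_of_affineChi_mem hκ hs hz).2

theorem fderiv_chi (hκ : 3 ≤ κ) {s : Fin κ → ℕ} (hs : s ∈ sizeVectors κ n) {z : Fin n → ℂ}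
    (hz : z ∈ openPiece κ n s) :
    (fderiv ℝ (chi κ n s) z : (Fin n → ℂ) →ₗ[ℝ] ParamSpace s) = linearChi n s := by
  have h : chi κ n s =ᶠ[nhds z] affineChi n s :=
    (chi_eqOn_openPiece hκ hs).eventuallyEq_of_mem ((isOpen_openPiece s).mem_nhds hz)
  rw [h.fderiv_eq, (hasFDerivAt_affineChi s z).fderiv]
  rfl

/-- The map `affineChi` has a smooth inverse, because its linear part has a nonzero
determinant. -/
theorem exists_inverse_affineChi (hκ : 3 ≤ κ) {s : Fin κ → ℕ} (hs : s ∈ sizeVectors κ n) :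
    ∃ h : ParamSpace s → (Fin n → ℂ), ContDiff ℝ ∞ h ∧ (∀ z, h (affineChi n s z) = z) ∧
      ∀ x, affineChi n s (h x) = x := by
  obtain ⟨e, he⟩ := exists_detWith_linearChi (n := n) hκ hs
  have hne : detWith e (linearChi n s) ≠ 0 := by
    rw [he]
    have := sin_theta_pos hκ
    positivity
  obtain ⟨M, hM⟩ := exists_linearEquiv_of_detWith_ne_zero e _ hne
  refine ⟨fun x => M.symm (x - affineChi n s 0), ?_, fun z => ?_, fun x => ?_⟩
  · exact M.symm.toContinuousLinearEquiv.contDiff.comp (contDiff_id.sub contDiff_const)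
  · change M.symm (affineChi n s z - _) = z
    rw [affineChi_eq s z, add_sub_cancel_right, ← hM, LinearEquiv.symm_apply_apply]
  · rw [affineChi_eq, ← hM, LinearEquiv.apply_symm_apply, sub_add_cancel]

/-- Every point of `openParamSet` is the parameter of a tuple, since `affineChi` is onto. -/
theorem image_affineChi_openPiece (hκ : 3 ≤ κ) {s : Fin κ → ℕ} (hs : s ∈ sizeVectors κ n) :
    affineChi n s '' openPiece κ n s = openParamSet κ s := by
  obtain ⟨h, -, -, hr⟩ := exists_inverse_affineChi hκ hs
  exact image_preimage_eq _ fun x => ⟨h x, hr x⟩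

theorem image_chi_openPiece (hκ : 3 ≤ κ) {s : Fin κ → ℕ} (hs : s ∈ sizeVectors κ n) :
    chi κ n s '' openPiece κ n s = openParamSet κ s :=
  (chi_eqOn_openPiece hκ hs).image_eq.trans (image_affineChi_openPiece hκ hs)

theorem isPiecewiseDiffeo_chi (hκ : 3 ≤ κ) {s : Fin κ → ℕ} (hs : s ∈ sizeVectors κ n) :
    IsPiecewiseDiffeo (chi κ n s) (convexTuplesOfSize κ n s) (paramSet κ s)
      fun _ : Fin 1 => openPiece κ n s := by
  have hint : interior (openPiece κ n s) = openPiece κ n s := (isOpen_openPiece s).interior_eq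
  have himg := image_chi_openPiece hκ hs
  constructor
  · exact fun _ => (isOpen_openPiece s).measurableSet.nullMeasurableSet
  · exact fun _ z hz => (mem_convexTuplesOfSize_of_affineChi_mem hκ hs hz).1
  · exact Subsingleton.pairwise
  · rw [hint, iUnion_const]
    exact volume_convexTuplesOfSize_diff hκ hs
  · rw [hint]
    exact fun _ => (contDiff_affineChi s).contDiffOn.congr (chi_eqOn_openPiece hκ hs)
  · rw [hint, himg]
    exact fun _ => isOpen_openParamSet s
  · rw [hint]
    obtain ⟨h, hsm, hl, -⟩ := exists_inverse_affineChi hκ hs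
    refine fun _ => ⟨h, hsm.contDiffOn, fun z hz => ?_⟩
    rw [chi_eqOn_openPiece hκ hs hz, hl]
  · rw [hint, himg]
    exact fun _ x hx => hx.1
  · exact Subsingleton.pairwise
  · rw [hint, himg, iUnion_const]
    exact volume_paramSet_diff s

theorem volume_convexTuplesOfSize_eq (hκ : 3 ≤ κ) {s : Fin κ → ℕ} (hs : s ∈ sizeVectors κ n) :
    volume (convexTuplesOfSize κ n s) = volume (openPiece κ n s) := by
  refine le_antisymm ?_ (measure_mono fun z hz =>
    (mem_convexTuplesOfSize_of_affineChi_mem hκ hs hz).1)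
  have := measure_le_inter_add_sdiff volume (convexTuplesOfSize κ n s) (openPiece κ n s)
  rw [openPiece, volume_convexTuplesOfSize_diff hκ hs, add_zero] at this
  exact this.trans (measure_mono inter_subset_right)

theorem volume_paramSet_eq (s : Fin κ → ℕ) :
    volume (paramSet κ s) = volume (openParamSet κ s) := by
  refine le_antisymm ?_ (measure_mono fun x hx => hx.1)
  have := measure_le_inter_add_sdiff volume (paramSet κ s) (openParamSet κ s)
  rw [volume_paramSet_diff, add_zero] at this
  exact this.trans (measure_mono inter_subset_right)

theorem volume_openParamSet (hκ : 3 ≤ κ) {s : Fin κ → ℕ} (hs : s ∈ sizeVectors κ n) :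
    volume (openParamSet κ s) =
      ENNReal.ofReal (1 / Real.sin (theta κ) ^ ((n : ℤ) - (κ : ℤ))) * volume (openPiece κ n s) := by
  obtain ⟨e, he⟩ := exists_detWith_linearChi (n := n) hκ hs
  have hpos : 0 < 1 / Real.sin (theta κ) ^ ((n : ℤ) - (κ : ℤ)) := by
    have := sin_theta_pos hκ
    positivity
  have h1 : affineChi n s '' openPiece κ n s =
      (fun x => x + affineChi n s 0) '' (linearChi n s '' openPiece κ n s) := by
    rw [image_image]
    exact image_congr fun z _ => affineChi_eq s z
  rw [← image_affineChi_openPiece hκ hs, h1, image_add_right, measure_preimage_add_right,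
    volume_image_eq e, he, abs_of_pos hpos]

end Kgon

theorem mainTheorem7 (κ n : ℕ) [NeZero κ] [NeZero n] (hκ : 3 ≤ κ) (s : Fin κ → ℕ)
    (hs : s ∈ Kgon.sizeVectors κ n) :
    (∃ (m : ℕ) (P : Fin m → Set (Fin n → ℂ))
        (e : (Σ _ : Fin n, Fin 2) ≃ Fin κ ⊕ (Σ j : Fin κ, Fin (Kgon.numPart s j))),
      Kgon.IsPiecewiseDiffeo (Kgon.chi κ n s) (Kgon.convexTuplesOfSize κ n s)
        (Kgon.paramSet κ s) P ∧
      ∀ i, ∀ z ∈ interior (P i),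
        Kgon.detWith e (fderiv ℝ (Kgon.chi κ n s) z : (Fin n → ℂ) →ₗ[ℝ] Kgon.ParamSpace s) =
          1 / Real.sin (Kgon.theta κ) ^ ((n : ℤ) - (κ : ℤ))) ∧
    MeasureTheory.volume (Kgon.convexTuplesOfSize κ n s) =
      MeasureTheory.volume (Kgon.paramSet κ s) *
        ENNReal.ofReal (Real.sin (Kgon.theta κ) ^ ((n : ℤ) - (κ : ℤ))) := by
  obtain ⟨e, he⟩ := Kgon.exists_detWith_linearChi (n := n) hκ hs
  refine ⟨⟨1, fun _ => Kgon.openPiece κ n s, e, Kgon.isPiecewiseDiffeo_chi hκ hs,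
    fun _ z hz => ?_⟩, ?_⟩
  · rw [Kgon.fderiv_chi hκ hs (interior_subset hz), he]
  · have hpos : 0 < Real.sin (Kgon.theta κ) ^ ((n : ℤ) - (κ : ℤ)) := by
      have := Kgon.sin_theta_pos hκ
      positivity
    rw [Kgon.volume_convexTuplesOfSize_eq hκ hs, Kgon.volume_paramSet_eq,
      Kgon.volume_openParamSet hκ hs, mul_right_comm, ← ENNReal.ofReal_mul (by positivity),
      one_div_mul_cancel hpos.ne', ENNReal.ofReal_one, one_mul]
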